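/- Let $\mathbf{Cat}$ be the strict 2-category of small categories and $\mathbf{CAT}$ that of (possibly large) categories. A \emph{prederivator} is a strict 2-functor $\mathscr D\colon\mathbf{Cat}^{\mathrm{op}}\to\mathbf{CAT}$ (1-cells are reversed, 2-cells are not). For small categories $A,I$, its \emph{partial underlying diagram functor} $\mathscr D(A\times I)\to\mathscr D(A)^I$ sends $X$ to the diagram $i\mapsto \mathrm{incl}_i^*X$, where $\mathrm{incl}_i\colon A\to A\times I$, $a\mapsto(a,i)$; a morphism $i\to j$ acts through the induced natural transformation $\mathrm{incl}_i\Rightarrow\mathrm{incl}_j$. For the terminal category $A=*$ this is the \emph{underlying diagram functor} $\mathscr D(I)\to\mathscr D(*)^I$. A small category is \emph{free} if it is isomorphic to the path category of a small quiver. The prederivator $\mathscr D$ is \emph{strong} if $\mathscr D(A\times F)\to\mathscr D(A)^F$ is full and essentially surjective for every small category $A$ and every small free category $F$. For a (possibly large) quasi-category $\mathscr C$, let $\mathscr{H}o_\infty(\mathscr C)$ be the prederivator $I\mapsto \mathrm h(\mathscr C^{\mathrm N I})$, where $\mathrm N$ is the nerve, $\mathscr C^{K}$ is the simplicial set of maps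 $K\to\mathscr C$, and $\mathrm h$ is the homotopy category functor (left adjoint to the nerve). A functor $f\colon I\to J$ acts by restriction along $\mathrm N f$, and a natural transformation $\tau\colon f\Rightarrow g$ of functors $I\to J$ acts by the natural transformation $f^*\Rightarrow g^*$ whose component at $x\colon\mathrm N J\to\mathscr C$ is the class of the edge $\mathrm N I\times\Delta^1\to\mathrm N J\xrightarrow{x}\mathscr C$ of $\mathscr C^{\mathrm N I}$ determined by $\tau$. \textbf{Proposition.} For every quasi-category $\mathscr C$ the following hold. \begin{enumerate} \item The prederivator $\mathscr{H}o_\infty(\mathscr C)$ is strong. \item For every small free category $F$, the underlying diagram functor $\mathrm h(\mathscr C^{\mathrm N F})\to(\mathrm h\mathscr C)^F$ (where $\mathscr{H}o_\infty(\mathscr C)(*)=\mathrm h(\mathscr C^{\mathrm N *})$ is identified with $\mathrm h\mathscr C$ by evaluation at the vertex of $\mathrm N *$) is full and essentially surjective. \item For every small category $A$ and every small free category $F$, the same holds with $\mathscr C$ replaced by $\mathscr C^{\mathrm N A}$: the functor $\mathrm h\big((\mathscr C^{\mathrm N A})^{\mathrm N F}\big)\to\big(\mathrm h(\mathscr C^{\mathrm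 N A})\big)^F$ is full and essentially surjective. \end{enumerate} -/

import Mathlib

open CategoryTheory Simplicial Opposite MonoidalCategory
open SimplicialObject.Truncated
open SSet.Truncated (HomotopyCategory mapHomotopyCategory)

/-! ### Prederivators -/

/-- A prederivator is a strict 2-functor `Catᵒᵖ ⥤ CAT`. Here `Cat` is the strict 2-category of
`u`-small categories, `CAT` is the one of `w`-small categories, and `ᵒᵖ` reverses the 1-cells
but not the 2-cells. -/
abbrev Prederivator.{u, w} := StrictPseudofunctor (Cat.{u, u})ᵒᵖ Cat.{w, w}

namespace Prederivator

universe u w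

/-- A functor `P : I ⥤ (A ⥤ B)` of small categories induces, for every prederivator `D`, the
functor `D(B) ⥤ (I ⥤ D(A))` which sends `X` to the diagram `i ↦ (P i)^* X`. -/
def restrictAlong (D : Prederivator.{u, w}) {A B I : Cat.{u, u}} (P : I ⥤ (A ⥤ B)) :
    D.obj (op B) ⥤ (I ⥤ D.obj (op A)) where
  obj X :=
    { obj i := (D.map (P.obj i).toCatHom.op).toFunctor.obj X
      map f := (D.map₂ (Bicategory.Opposite.op2 (P.map f).toCatHom₂)).toNatTrans.app X
      map_id i := by
        rw [P.map_id, NatTrans.toCatHom₂_id, Bicategory.Opposite.op2_id, D.map₂_id]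
        rfl
      map_comp f g := by
        rw [P.map_comp, NatTrans.toCatHom₂_comp, Bicategory.Opposite.op2_comp, D.map₂_comp]
        rfl }
  map φ :=
    { app i := (D.map (P.obj i).toCatHom.op).toFunctor.map φ
      naturality _ _ f :=
        ((D.map₂ (Bicategory.Opposite.op2 (P.map f).toCatHom₂)).toNatTrans.naturality φ).symm }

/-- The terminal category `*`. -/
abbrev point : Cat.{u, u} := Cat.of (Discrete PUnit.{u + 1})

/-- The underlying diagram functor `D(I) ⥤ D(*)^I`, sending `X` to `i ↦ (incl_i)^* X`, where
`incl_i : * ⥤ I` is the functor with value `i`. -/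
def diag (D : Prederivator.{u, w}) (I : Cat.{u, u}) :
    D.obj (op I) ⥤ (I ⥤ D.obj (op point.{u})) :=
  D.restrictAlong (A := point.{u}) (B := I) (I := I) (Functor.const (Discrete PUnit.{u + 1}))

/-- The partial underlying diagram functor `D(A × I) ⥤ D(A)^I`, sending `X` to
`i ↦ (incl_i)^* X`, where `incl_i : A ⥤ A × I` is the functor `a ↦ (a, i)`. -/
def partialDiag (D : Prederivator.{u, w}) (A I : Cat.{u, u}) :
    D.obj (op (Cat.of (A × I))) ⥤ (I ⥤ D.obj (op A)) :=
  D.restrictAlong (A := A) (B := Cat.of (A × I)) (I := I) (Functor.curry.obj (𝟭 (A × I))).flip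

/-- A small category is free if it is isomorphic to the path category of a (small) quiver. -/
def IsFreeCategory (F : Cat.{u, u}) : Prop :=
  ∃ Q : Quiv.{u, u}, Nonempty (F ≅ Cat.free.obj Q)

/-- A prederivator is strong if all partial underlying diagram functors for small free
categories are full and essentially surjective. -/
def IsStrong (D : Prederivator.{u, w}) : Prop :=
  ∀ A F : Cat.{u, u}, IsFreeCategory F → (D.partialDiag A F).Full ∧ (D.partialDiag A F).EssSurj

end Prederivator

/-! ### Mapping simplicial sets -/

namespace SSet

universe w

/-- The simplicial set `C ^ K` of maps `K ⟶ C`, i.e. the value at `C` of the right adjoint of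
`K × -`. Its `n`-simplices are the simplicial maps `K × Δ[n] ⟶ C`, encoded as natural families
of maps `K_m → C_m` indexed by `[m] ⟶ [n]`. -/
def expo (C K : SSet.{w}) : SSet.{w} := Functor.functorHom K C

variable (C : SSet.{w})

/-- Restriction `C ^ L ⟶ C ^ K` along a map `K ⟶ L`. -/
def precomp {K L : SSet.{w}} (f : K ⟶ L) : expo C L ⟶ expo C K where
  app n := ↾fun (x : Functor.HomObj L C _) ↦
    ({ app := fun d a ↦ f.app d ≫ x.app d a
       naturality := fun φ a ↦ by
        rw [← Category.assoc, f.naturality, Category.assoc, x.naturality, Category.assoc] } :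
      Functor.HomObj K C _)

lemma precomp_id (K : SSet.{w}) : precomp C (𝟙 K) = 𝟙 _ := rfl

lemma precomp_comp {K L M : SSet.{w}} (f : K ⟶ L) (g : L ⟶ M) :
    precomp C (f ≫ g) = precomp C g ≫ precomp C f := rfl

variable {I J : Type w} [SmallCategory I] [SmallCategory J]

/-- The map of simplicial sets `N(J ^ I) ⟶ (N J) ^ (N I)` adjoint to the nerve of the evaluation
functor: for `S : [n] ⥤ (I ⥤ J)`, `a : [m] ⟶ [n]` and `σ : [m] ⥤ I` it takes the `m`-simplex
`k ↦ S (a k) (σ k)` of `N J`. -/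
def nerveExpo (I J : Type w) [SmallCategory I] [SmallCategory J] :
    nerve (I ⥤ J) ⟶ expo (nerve J) (nerve I) where
  app n := ↾fun (S : ComposableArrows (I ⥤ J) n.unop.len) ↦
    ({ app := fun d (a : n ⟶ d) ↦ ↾fun (σ : ComposableArrows I d.unop.len) ↦
        (((SimplexCategory.toCat.map a.unop).toFunctor.prod' σ) ⋙ Functor.uncurry.obj S :
          ComposableArrows J d.unop.len)
       naturality := fun _ _ ↦ rfl } :
      Functor.HomObj (nerve I) (nerve J) _)
  naturality _ _ _ := rfl

/-- The action map `N(J ^ I) × C ^ (N J) ⟶ C ^ (N I)`: composition of maps after applying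
`nerveExpo`. -/
def nerveAct (I J : Type w) [SmallCategory I] [SmallCategory J] :
    nerve (I ⥤ J) ⊗ expo C (nerve J) ⟶ expo C (nerve I) where
  app n := ↾fun z ↦ Functor.HomObj.comp ((nerveExpo I J).app n z.1 : Functor.HomObj _ _ _)
    (z.2 : Functor.HomObj (nerve J) C _)
  naturality _ _ _ := rfl

lemma prod'_uncurry_const {A M : Type*} [Category* A] [Category* M] (P : A ⥤ M) (σ : A ⥤ I)
    (f : I ⥤ J) :
    P.prod' σ ⋙ Functor.uncurry.obj ((Functor.const M).obj f) = σ ⋙ f := by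
  refine CategoryTheory.Functor.ext (fun _ ↦ rfl) ?_
  intros
  simp

lemma prod'_uncurry_whiskeringRight {A M : Type*} [Category* A] [Category* M]
    {K : Type w} [SmallCategory K] (P : A ⥤ M) (σ : A ⥤ I) (S : M ⥤ I ⥤ J) (g : J ⥤ K) :
    P.prod' σ ⋙ Functor.uncurry.obj (S ⋙ (Functor.whiskeringRight I J K).obj g) =
      (P.prod' σ ⋙ Functor.uncurry.obj S) ⋙ g := by
  refine CategoryTheory.Functor.ext (fun _ ↦ rfl) ?_
  intros
  simp

/-- The action of an `n`-simplex of `N(J ^ I)` on an `n`-simplex of `C ^ (N J)`. -/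
def act {n : ℕ} (S : ComposableArrows (I ⥤ J) n) (z : (expo C (nerve J)) _⦋n⦌) :
    (expo C (nerve I)) _⦋n⦌ :=
  (nerveAct C I J).app (op ⦋n⦌) ((S : (nerve (I ⥤ J)) _⦋n⦌), z)

lemma δ_act {n : ℕ} (i : Fin (n + 2)) (S : ComposableArrows (I ⥤ J) (n + 1))
    (z : (expo C (nerve J)) _⦋n + 1⦌) :
    (expo C (nerve I)).δ i (act C S z) =
      act C ((nerve (I ⥤ J)).δ i S) ((expo C (nerve J)).δ i z) := rfl

lemma act_const {n : ℕ} (f : I ⥤ J) (z : (expo C (nerve J)) _⦋n⦌) :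
    act C ((Functor.const (Fin (n + 1))).obj f) z = (precomp C (nerveMap f)).app _ z := by
  suffices h : (nerveExpo I J).app (op ⦋n⦌) ((Functor.const (Fin (n + 1))).obj f) =
      (Functor.HomObj.ofNatTrans (nerveMap f) : Functor.HomObj (nerve I) (nerve J) _) from
    congrArg (fun t ↦ Functor.HomObj.comp t (z : Functor.HomObj (nerve J) C _)) h
  refine Functor.HomObj.ext ?_
  funext d a
  ext σ
  exact prod'_uncurry_const _ _ _

lemma act_whiskerLeft {K : Type w} [SmallCategory K] (g : K ⥤ I) {n : ℕ}
    (S : ComposableArrows (I ⥤ J) n) (z : (expo C (nerve J)) _⦋n⦌) :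
    act C (S ⋙ (Functor.whiskeringLeft K I J).obj g) z =
      (precomp C (nerveMap g)).app _ (act C S z) := rfl

lemma act_whiskerRight {K : Type w} [SmallCategory K] (g : J ⥤ K) {n : ℕ}
    (S : ComposableArrows (I ⥤ J) n) (z : (expo C (nerve K)) _⦋n⦌) :
    act C (S ⋙ (Functor.whiskeringRight I J K).obj g) z =
      act C S ((precomp C (nerveMap g)).app _ z) := by
  suffices h : (nerveExpo I K).app (op ⦋n⦌) (S ⋙ (Functor.whiskeringRight I J K).obj g) =
      Functor.HomObj.comp ((nerveExpo I J).app (op ⦋n⦌) S : Functor.HomObj (nerve I) (nerve J) _)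
        (Functor.HomObj.ofNatTrans (nerveMap g)) from
    congrArg (fun t ↦ Functor.HomObj.comp t (z : Functor.HomObj (nerve K) C _)) h
  refine Functor.HomObj.ext ?_
  funext d a
  ext σ
  exact prod'_uncurry_whiskeringRight _ _ _ _

lemma act_congr {n : ℕ} {S S' : ComposableArrows (I ⥤ J) n} (hS : S = S')
    {z z' : (expo C (nerve J)) _⦋n⦌} (hz : z = z') : act C S z = act C S' z' := by
  rw [hS, hz]

variable {f g h : I ⥤ J}

lemma δ_one_mk₁ (τ : f ⟶ g) : (nerve (I ⥤ J)).δ 1 (ComposableArrows.mk₁ τ) =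
    (Functor.const (Fin 1)).obj f := ComposableArrows.ext₀ rfl

lemma δ_zero_mk₁ (τ : f ⟶ g) : (nerve (I ⥤ J)).δ 0 (ComposableArrows.mk₁ τ) =
    (Functor.const (Fin 1)).obj g := ComposableArrows.ext₀ rfl

/-- The edge of `C ^ (N I)` from `x ∘ N f` to `y ∘ N g` given by a natural transformation
`τ : f ⟶ g` and an edge `e` of `C ^ (N J)` from `x` to `y`. -/
def actEdge (τ : f ⟶ g) {x y : (expo C (nerve J)) _⦋0⦌} (e : Edge x y) :
    Edge ((precomp C (nerveMap f)).app _ x) ((precomp C (nerveMap g)).app _ y) :=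
  Edge.mk (act C (ComposableArrows.mk₁ τ) e.edge)
    ((δ_act C _ _ _).trans (Eq.trans (act_congr C (δ_one_mk₁ τ) e.src_eq)
      (act_const C f x)))
    ((δ_act C _ _ _).trans (Eq.trans (act_congr C (δ_zero_mk₁ τ) e.tgt_eq)
      (act_const C g y)))

/-- The edge of `C ^ (N I)` from `x ∘ N f` to `x ∘ N g` given by a natural transformation
`τ : f ⟶ g`, i.e. the composite `N I × Δ[1] ⟶ N J ⟶ C` of the homotopy `N τ` and `x`. -/
abbrev natEdge (τ : f ⟶ g) (x : (expo C (nerve J)) _⦋0⦌) :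
    Edge ((precomp C (nerveMap f)).app _ x) ((precomp C (nerveMap g)).app _ x) :=
  actEdge C τ (Edge.id x)

lemma mk₁_id (f : I ⥤ J) : ComposableArrows.mk₁ (𝟙 f) = (Functor.const (Fin 2)).obj f :=
  ComposableArrows.mk₁_hom ((Functor.const (Fin 2)).obj f : ComposableArrows _ 1)

lemma actEdge_id (f : I ⥤ J) {x y : (expo C (nerve J)) _⦋0⦌} (e : Edge x y) :
    actEdge C (𝟙 f) e = e.map (precomp C (nerveMap f)) :=
  Edge.ext ((act_congr C (mk₁_id f) rfl).trans (act_const C _ _))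

/-- The edges `actEdge` are compatible with composition. -/
def actEdgeComp (τ : f ⟶ g) (τ' : g ⟶ h) {x y z : (expo C (nerve J)) _⦋0⦌}
    {e₀₁ : Edge x y} {e₁₂ : Edge y z} {e₀₂ : Edge x z} (c : Edge.CompStruct e₀₁ e₁₂ e₀₂) :
    Edge.CompStruct (actEdge C τ e₀₁) (actEdge C τ' e₁₂) (actEdge C (τ ≫ τ') e₀₂) :=
  Edge.CompStruct.mk (act C (ComposableArrows.mk₂ τ τ') c.simplex)
    ((δ_act C _ _ _).trans (act_congr C (nerve.δ₂_mk₂_eq _ _) c.d₂))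
    ((δ_act C _ _ _).trans (act_congr C (nerve.δ₀_mk₂_eq _ _) c.d₀))
    ((δ_act C _ _ _).trans (act_congr C (nerve.δ₁_mk₂_eq _ _) c.d₁))

lemma natEdge_whiskerRight {K : Type w} [SmallCategory K] (τ : f ⟶ g) (k : J ⥤ K)
    (x : (expo C (nerve K)) _⦋0⦌) :
    (natEdge C (Functor.whiskerRight τ k) x).edge =
      (natEdge C τ ((precomp C (nerveMap k)).app _ x)).edge := by
  have h : ComposableArrows.mk₁ (Functor.whiskerRight τ k) =
      ComposableArrows.mk₁ τ ⋙ (Functor.whiskeringRight I J K).obj k :=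
    ComposableArrows.mk₁_hom
      (ComposableArrows.mk₁ τ ⋙ (Functor.whiskeringRight I J K).obj k : ComposableArrows _ 1)
  exact (act_congr C h rfl).trans ((act_whiskerRight C k _ _).trans rfl)

lemma natEdge_whiskerLeft {K : Type w} [SmallCategory K] (k : K ⥤ I) (τ : f ⟶ g)
    (x : (expo C (nerve J)) _⦋0⦌) :
    (natEdge C (Functor.whiskerLeft k τ) x).edge =
      ((natEdge C τ x).map (precomp C (nerveMap k))).edge := by
  have h : ComposableArrows.mk₁ (Functor.whiskerLeft k τ) =
      ComposableArrows.mk₁ τ ⋙ (Functor.whiskeringLeft K I J).obj k :=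
    ComposableArrows.mk₁_hom
      (ComposableArrows.mk₁ τ ⋙ (Functor.whiskeringLeft K I J).obj k : ComposableArrows _ 1)
  exact (act_congr C h rfl).trans rfl

/-- The homotopy category `h X` of a simplicial set. -/
abbrev ho (X : SSet.{w}) : Cat.{w, w} := hoFunctor.obj X

/-- The natural transformation between the restriction functors
`(N f)^*, (N g)^* : h (C ^ (N J)) ⥤ h (C ^ (N I))` induced by `τ : f ⟶ g`; its component at
`x` is the class of the edge `natEdge C τ x`. -/
def hoNatTrans (τ : f ⟶ g) :
    mapHomotopyCategory ((truncation 2).map (precomp C (nerveMap f))) ⟶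
      mapHomotopyCategory ((truncation 2).map (precomp C (nerveMap g))) :=
  HomotopyCategory.mkNatTrans (fun x ↦ HomotopyCategory.homMk (natEdge C τ x).toTruncated)
    (by
      intro (x : (expo C (nerve J)) _⦋0⦌) (y : (expo C (nerve J)) _⦋0⦌) (e : Edge x y)
      change HomotopyCategory.homMk (e.map (precomp C (nerveMap f))).toTruncated ≫ _ =
        _ ≫ HomotopyCategory.homMk (e.map (precomp C (nerveMap g))).toTruncated
      have h₁ := HomotopyCategory.homMk_comp_homMk
        (actEdgeComp C (𝟙 f) τ (Edge.CompStruct.compId e)).toTruncated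
      have h₂ := HomotopyCategory.homMk_comp_homMk
        (actEdgeComp C τ (𝟙 g) (Edge.CompStruct.idComp e)).toTruncated
      rw [actEdge_id, Category.id_comp] at h₁
      rw [actEdge_id, Category.comp_id] at h₂
      exact h₁.trans h₂.symm)

lemma homMk_eq_of_edge_eq {V : Truncated.{w} 2} {x y x' y' : V _⦋0⦌₂} (e : Truncated.Edge x y)
    (e' : Truncated.Edge x' y') (he : e.edge = e'.edge)
    (hx : HomotopyCategory.mk x = HomotopyCategory.mk x')
    (hy : HomotopyCategory.mk y' = HomotopyCategory.mk y) :
    HomotopyCategory.homMk e = eqToHom hx ≫ HomotopyCategory.homMk e' ≫ eqToHom hy := by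
  obtain rfl : x = x' := by rw [← e.src_eq, ← e'.src_eq, he]
  obtain rfl : y = y' := by rw [← e.tgt_eq, ← e'.tgt_eq, he]
  obtain rfl : e = e' := Truncated.Edge.ext he
  simp

lemma hoNatTrans_id (f : I ⥤ J) : hoNatTrans C (𝟙 f) = 𝟙 _ := by
  ext x
  obtain ⟨x, rfl⟩ := HomotopyCategory.mk_surjective x
  refine (congrArg (fun e : Edge _ _ ↦ HomotopyCategory.homMk e.toTruncated)
    (actEdge_id C f (Edge.id x))).trans ?_
  exact HomotopyCategory.homMk_id _

lemma hoNatTrans_comp (τ : f ⟶ g) (τ' : g ⟶ h) :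
    hoNatTrans C (τ ≫ τ') = hoNatTrans C τ ≫ hoNatTrans C τ' := by
  ext x
  obtain ⟨x, rfl⟩ := HomotopyCategory.mk_surjective x
  exact (HomotopyCategory.homMk_comp_homMk
    (actEdgeComp C τ τ' (Edge.CompStruct.idCompId x)).toTruncated).symm

end SSet

/-! ### The prederivator of a simplicial set -/

namespace Prederivator

universe u v

open SSet

lemma strict_op_cat : Bicategory.Strict (Cat.{u, u})ᵒᵖ where
  id_comp _ := Category.id_comp _
  comp_id _ := Category.comp_id _
  assoc _ _ _ := Category.assoc _ _ _
  leftUnitor_eqToIso _ := rfl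
  rightUnitor_eqToIso _ := rfl
  associator_eqToIso _ _ _ := rfl

lemma cat_hom₂_eq {X Y : Cat.{u, v}} {F F' G G' : X ⟶ Y} (hF : F = F') (hG : G' = G)
    (α : F ⟶ G) (β : F' ⟶ G')
    (H : ∀ (x : X) (h₁ : F.toFunctor.obj x = F'.toFunctor.obj x)
      (h₂ : G'.toFunctor.obj x = G.toFunctor.obj x),
      α.toNatTrans.app x = eqToHom h₁ ≫ β.toNatTrans.app x ≫ eqToHom h₂) :
    α = eqToHom hF ≫ β ≫ eqToHom hG := by
  subst hF hG
  ext x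
  simpa using H x rfl rfl

/-- The nerve of a `u`-small category, regarded as a `max u v`-small simplicial set. -/
abbrev smallNerve (I : Cat.{u, u}) : SSet.{max u v} := nerve (AsSmall.{v} I)

/-- The functor `AsSmall I ⥤ AsSmall J` given by a functor `I ⥤ J`. -/
abbrev lift {I J : Cat.{u, u}} (F : I ⥤ J) : AsSmall.{v} I ⥤ AsSmall.{v} J :=
  AsSmall.down ⋙ F ⋙ AsSmall.up

/-- The natural transformation `lift F ⟶ lift G` given by `F ⟶ G`. -/
abbrev liftNat {I J : Cat.{u, u}} {F G : I ⥤ J} (τ : F ⟶ G) : lift.{u, v} F ⟶ lift G :=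
  Functor.whiskerLeft AsSmall.down (Functor.whiskerRight τ AsSmall.up)

/-- The homotopy prederivator `I ↦ h (C ^ (N I))` of a simplicial set `C`; functors `I ⥤ J` act by
restriction along their nerves, and natural transformations act by `hoNatTrans`. -/
def hoInfinity (C : SSet.{max u v}) : Prederivator.{u, max u v} :=
  letI := strict_op_cat.{u}
  StrictPseudofunctor.mk''
    { obj I := ho (expo C (smallNerve.{u, v} I.unop))
      map F := hoFunctor.map (precomp C (nerveMap (lift F.unop.toFunctor)))
      map₂ τ := (hoNatTrans C (liftNat τ.unop2.toNatTrans)).toCatHom₂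
      map₂_id F := congrArg NatTrans.toCatHom₂ (hoNatTrans_id C (lift F.unop.toFunctor))
      map₂_comp τ τ' := congrArg NatTrans.toCatHom₂ ((hoNatTrans_comp C
        (liftNat τ.unop2.toNatTrans) (liftNat τ'.unop2.toNatTrans)))
      map_id I := hoFunctor.map_id (expo C (smallNerve.{u, v} I.unop))
      map_comp F G := hoFunctor.map_comp (precomp C (nerveMap (lift F.unop.toFunctor)))
        (precomp C (nerveMap (lift G.unop.toFunctor)))
      map₂_whisker_left F _ _ η := by
        refine cat_hom₂_eq _ _ _ _ fun x h₁ h₂ ↦ ?_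
        obtain ⟨x, rfl⟩ := HomotopyCategory.mk_surjective x
        exact homMk_eq_of_edge_eq _ _ (natEdge_whiskerRight C (liftNat η.unop2.toNatTrans)
          (lift F.unop.toFunctor) x) h₁ h₂
      map₂_whisker_right η F := by
        refine cat_hom₂_eq _ _ _ _ fun x h₁ h₂ ↦ ?_
        obtain ⟨x, rfl⟩ := HomotopyCategory.mk_surjective x
        exact homMk_eq_of_edge_eq _ _ (natEdge_whiskerLeft C (lift F.unop.toFunctor)
          (liftNat η.unop2.toNatTrans) x) h₁ h₂ }

/-- Evaluation `C ^ K ⟶ C` at a vertex `k` of `K`. -/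
def evalVertex (C : SSet.{v}) {K : SSet.{v}} (k : K _⦋0⦌) : expo C K ⟶ C where
  app n := ↾fun x ↦ (x : Functor.HomObj K C _).app n (𝟙 n)
    (K.map (SimplexCategory.const n.unop ⦋0⦌ 0).op k)
  naturality n m f := by
    ext (x : Functor.HomObj K C _)
    have h := ConcreteCategory.congr_hom (x.naturality f (𝟙 n))
      (K.map (SimplexCategory.const n.unop ⦋0⦌ 0).op k)
    refine Eq.trans ?_ h
    change x.app m (f ≫ 𝟙 m) _ = x.app m (𝟙 n ≫ f) (K.map f (K.map _ k))
    rw [Category.comp_id, Category.id_comp, ← Functor.map_comp_apply]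
    rfl

/-- The unique vertex of `N *`. -/
abbrev pointVertex : (smallNerve.{u, v} point.{u}) _⦋0⦌ := ComposableArrows.mk₀ ⟨⟨⟨⟩⟩⟩

/-- The underlying diagram functor `h (C ^ (N F)) ⥤ (h C) ^ F` of the homotopy prederivator of `C`:
the functor `diag` followed by the identification `h (C ^ (N *)) = h C`, which is given by
evaluation at the vertex of `N *`. -/
def underlyingDiagram (C : SSet.{max u v}) (F : Cat.{u, u}) :
    ho (expo C (smallNerve.{u, v} F)) ⥤ (F ⥤ ho C) :=
  (hoInfinity.{u, v} C).diag F ⋙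
    (Functor.whiskeringRight _ _ _).obj (hoFunctor.map (evalVertex C pointVertex.{u, v})).toFunctor

end Prederivator

universe u v

/-! The nerve of a free category F is governed by its spine: the subcomplex of simplices of total
path length at most one, that is, the quiver itself. A map out of the spine is a choice of vertices
together with edges for the generating arrows (`spineDesc`). The inclusion of the spine into N F is
inner anodyne (`innerAnodyneExtensions_spine_ι`), because a path of length at least two factors
uniquely as an arrow followed by a path.

Essential surjectivity (`exists_nerveHo_iso`): a diagram F → hC is represented on generators by
vertices and edges of C, which extend from the spine to N F. The resulting diagram agrees with the
given one on generators, hence is isomorphic to it.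

Fullness (`exists_edge_of_natTrans`): the components of a natural transformation between the
diagrams of z, w : N F → C are represented by edges. In a quasi-category an equation between
composites in hC is witnessed by a 2-simplex (`nonempty_compStruct_of_fac`), so each naturality
square at a generator is filled by two triangles with a common diagonal. These squares form a map
from the spine to C^Δ[1] lying over (z, w). Restriction of C^Δ[1] to the two end points is an inner
fibration, so the map lifts to N F → C^Δ[1], which is the same as an edge from z to w in C^(N F).

Since C^(N A) is again a quasi-category, the third assertion is an instance of the second. The
exponential law C^(N(A × F)) ≅ (C^(N A))^(N F) identifies the partial diagram functor of C with the
diagram functor of C^(N A) (`partialDiagIso`), which gives strongness. -/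

namespace SSet

universe w

/-! ### Low-dimensional inner horns in a quasi-category -/

section Quasicategory

variable {X : SSet.{w}} [Quasicategory X]

lemma exists_horn₂₁_filler (a b : X _⦋1⦌) (h : X.δ 0 a = X.δ 1 b) :
    ∃ s : X _⦋2⦌, X.δ 2 s = a ∧ X.δ 0 s = b := by
  have w : stdSimplex.δ (0 : Fin 2) ≫ yonedaEquiv.symm a =
      stdSimplex.δ (1 : Fin 2) ≫ yonedaEquiv.symm b := by
    rw [stdSimplex.δ_comp_yonedaEquiv_symm, stdSimplex.δ_comp_yonedaEquiv_symm, h]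
  obtain ⟨σ, hσ⟩ := Quasicategory.hornFilling (S := X) (n := 2) (i := 1) (by decide) (by decide)
    (horn₂₁.isPushout.desc _ _ w)
  refine ⟨yonedaEquiv σ, ?_, ?_⟩
  · rw [← stdSimplex.yonedaEquiv_δ_comp, ← horn.ι_ι 1 2 (by simp), Category.assoc, ← hσ,
      horn₂₁.isPushout.inl_desc]
    simp
  · rw [← stdSimplex.yonedaEquiv_δ_comp, ← horn.ι_ι 1 0 (by simp), Category.assoc, ← hσ,
      horn₂₁.isPushout.inr_desc]
    simp

lemma exists_horn₃₁_filler (s₀ s₂ s₃ : X _⦋2⦌) (h₁₂ : X.δ 2 s₀ = X.δ 0 s₃)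
    (h₁₃ : X.δ 1 s₀ = X.δ 0 s₂) (h₂₃ : X.δ 2 s₂ = X.δ 2 s₃) :
    ∃ s : X _⦋3⦌, X.δ 0 s = s₀ ∧ X.δ 2 s = s₂ ∧ X.δ 3 s = s₃ := by
  obtain ⟨φ, h₀, h₂, h₃⟩ := horn₃₁.exists_desc (yonedaEquiv.symm s₀) (yonedaEquiv.symm s₂)
    (yonedaEquiv.symm s₃) (by simp only [stdSimplex.δ_comp_yonedaEquiv_symm, h₁₂])
    (by simp only [stdSimplex.δ_comp_yonedaEquiv_symm, h₁₃])
    (by simp only [stdSimplex.δ_comp_yonedaEquiv_symm, h₂₃])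
  obtain ⟨σ, hσ⟩ := Quasicategory.hornFilling (S := X) (n := 3) (i := 1) (by decide) (by decide) φ
  refine ⟨yonedaEquiv σ, ?_, ?_, ?_⟩
  · rw [← stdSimplex.yonedaEquiv_δ_comp, ← horn.ι_ι 1 0 (by simp), Category.assoc, ← hσ, h₀]
    simp
  · rw [← stdSimplex.yonedaEquiv_δ_comp, ← horn.ι_ι 1 2 (by simp), Category.assoc, ← hσ, h₂]
    simp
  · rw [← stdSimplex.yonedaEquiv_δ_comp, ← horn.ι_ι 1 3 (by simp), Category.assoc, ← hσ, h₃]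
    simp

lemma exists_horn₃₂_filler (s₀ s₁ s₃ : X _⦋2⦌) (h₀₂ : X.δ 2 s₁ = X.δ 1 s₃)
    (h₁₂ : X.δ 2 s₀ = X.δ 0 s₃) (h₂₃ : X.δ 0 s₀ = X.δ 0 s₁) :
    ∃ s : X _⦋3⦌, X.δ 0 s = s₀ ∧ X.δ 1 s = s₁ ∧ X.δ 3 s = s₃ := by
  obtain ⟨φ, h₀, h₁, h₃⟩ := horn₃₂.exists_desc (yonedaEquiv.symm s₀) (yonedaEquiv.symm s₁)
    (yonedaEquiv.symm s₃) (by simp only [stdSimplex.δ_comp_yonedaEquiv_symm, h₀₂])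
    (by simp only [stdSimplex.δ_comp_yonedaEquiv_symm, h₁₂])
    (by simp only [stdSimplex.δ_comp_yonedaEquiv_symm, h₂₃])
  obtain ⟨σ, hσ⟩ := Quasicategory.hornFilling (S := X) (n := 3) (i := 2) (by decide) (by decide) φ
  refine ⟨yonedaEquiv σ, ?_, ?_, ?_⟩
  · rw [← stdSimplex.yonedaEquiv_δ_comp, ← horn.ι_ι 2 0 (by simp), Category.assoc, ← hσ, h₀]
    simp
  · rw [← stdSimplex.yonedaEquiv_δ_comp, ← horn.ι_ι 2 1 (by simp), Category.assoc, ← hσ, h₁]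
    simp
  · rw [← stdSimplex.yonedaEquiv_δ_comp, ← horn.ι_ι 2 3 (by simp), Category.assoc, ← hσ, h₃]
    simp

lemma Edge.nonempty_comp {x₀ x₁ x₂ : X _⦋0⦌} (e₀₁ : Edge x₀ x₁) (e₁₂ : Edge x₁ x₂) :
    Nonempty (Σ e₀₂ : Edge x₀ x₂, Edge.CompStruct e₀₁ e₁₂ e₀₂) := by
  obtain ⟨s, h₂, h₀⟩ := exists_horn₂₁_filler e₀₁.edge e₁₂.edge (by simp)
  refine ⟨Edge.mk (X.δ 1 s) ?_ ?_, Edge.CompStruct.mk s h₂ h₀ rfl⟩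
  · have := X.δ_comp_δ_apply (i := 1) (j := 1) le_rfl s
    rw [← e₀₁.src_eq, ← h₂]
    exact this.symm
  · have := X.δ_comp_δ_apply (i := 0) (j := 0) le_rfl s
    rw [← e₁₂.tgt_eq, ← h₀]
    exact this

variable {x₀ x₁ x₂ x₃ : X _⦋0⦌} {e₀₁ : Edge x₀ x₁} {e₁₂ : Edge x₁ x₂} {e₂₃ : Edge x₂ x₃}
  {e₀₂ : Edge x₀ x₂} {e₁₃ : Edge x₁ x₃} {e₀₃ : Edge x₀ x₃}

lemma Edge.CompStruct.nonempty_of_horn₃₁ (f₃ : CompStruct e₀₁ e₁₂ e₀₂)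
    (f₀ : CompStruct e₁₂ e₂₃ e₁₃) (f₂ : CompStruct e₀₁ e₁₃ e₀₃) :
    Nonempty (CompStruct e₀₂ e₂₃ e₀₃) := by
  obtain ⟨s, h₀, h₂, h₃⟩ := exists_horn₃₁_filler f₀.simplex f₂.simplex f₃.simplex
    (by simp) (by simp) (by simp)
  refine ⟨CompStruct.mk (X.δ 1 s) ?_ ?_ ?_⟩
  · rw [← f₃.d₁, ← h₃]
    exact (X.δ_comp_δ_apply (i := 1) (j := 2) (by decide) s).symm
  · rw [← f₀.d₀, ← h₀]
    exact X.δ_comp_δ_apply (i := 0) (j := 0) le_rfl s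
  · rw [← f₂.d₁, ← h₂]
    exact (X.δ_comp_δ_apply (i := 1) (j := 1) le_rfl s).symm

lemma Edge.CompStruct.nonempty_of_horn₃₂ (f₃ : CompStruct e₀₁ e₁₂ e₀₂)
    (f₀ : CompStruct e₁₂ e₂₃ e₁₃) (f₁ : CompStruct e₀₂ e₂₃ e₀₃) :
    Nonempty (CompStruct e₀₁ e₁₃ e₀₃) := by
  obtain ⟨s, h₀, h₁, h₃⟩ := exists_horn₃₂_filler f₀.simplex f₁.simplex f₃.simplex
    (by simp) (by simp) (by simp)
  refine ⟨CompStruct.mk (X.δ 2 s) ?_ ?_ ?_⟩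
  · rw [← f₃.d₂, ← h₃]
    exact (X.δ_comp_δ_apply (i := 2) (j := 2) le_rfl s).symm
  · rw [← f₀.d₁, ← h₀]
    exact (X.δ_comp_δ_apply (i := 0) (j := 1) (by decide) s)
  · rw [← f₁.d₁, ← h₁]
    exact (X.δ_comp_δ_apply (i := 1) (j := 1) le_rfl s)

/-- The fillers in dimensions two and three are all that is needed to describe hX by homotopy
classes of edges. -/
instance : Truncated.Quasicategory₂ ((truncation 2).obj X) where
  fill21 e₀₁ e₁₂ := Edge.nonempty_comp (X := X) e₀₁ e₁₂
  fill31 f₃ f₀ f₂ := Edge.CompStruct.nonempty_of_horn₃₁ (X := X) f₃ f₀ f₂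
  fill32 f₃ f₀ f₁ := Edge.CompStruct.nonempty_of_horn₃₂ (X := X) f₃ f₀ f₁

end Quasicategory

/-! ### Edges and 2-simplices representing morphisms and relations in the homotopy category -/

namespace Truncated.HomotopyCategory

variable {V : Truncated.{w} 2} [Quasicategory₂ V]

variable (V) in
/-- The functor from the homotopy category of a `2`-truncated quasicategory to the category of
homotopy classes of edges. -/
noncomputable def toHomotopyCategory₂ : V.HomotopyCategory ⥤ HomotopyCategory₂ V :=
  lift (fun x ↦ HomotopyCategory₂.mk x) (fun e ↦ HomotopyCategory₂.homMk e)
    (fun x ↦ HomotopyCategory₂.homMk_id (HomotopyCategory₂.mk x))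
    (fun h ↦ h.homotopyCategory₂_fac)

/-- The homotopy category is defined by generators and relations, so an equation there could a
priori need a chain of relations. Its image in the category of homotopy classes of edges shows that
a single 2-simplex suffices. -/
lemma nonempty_compStruct_of_fac {x y z : V _⦋0⦌₂} {f : Edge x y} {g : Edge y z} {h : Edge x z}
    (fac : homMk f ≫ homMk g = homMk h) : Nonempty (Edge.CompStruct f g h) := by
  rw [Edge.CompStruct.nonempty_iff]
  have := congrArg (toHomotopyCategory₂ V).map fac
  rw [Functor.map_comp] at this
  simpa [toHomotopyCategory₂] using! this

/-- The classes of edges generate, and they are closed under composition because inner 2-horns have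
fillers. -/
lemma exists_homMk_eq {x y : V _⦋0⦌₂} (f : mk x ⟶ mk y) : ∃ e : Edge x y, homMk e = f := by
  let W : MorphismProperty V.HomotopyCategory := fun x y f ↦
    ∃ e : Edge x.as.as y.as.as, homMk e = f
  have : W.IsMultiplicative :=
    { id_mem := by
        intro x
        obtain ⟨x, rfl⟩ := mk_surjective x
        exact ⟨Edge.id x, homMk_id x⟩
      comp_mem := by
        rintro x y z f g ⟨a, rfl⟩ ⟨b, rfl⟩
        exact ⟨Edge.comp a b, (homMk_comp_homMk (Edge.compStruct a b)).symm⟩ }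
  exact (morphismProperty_eq_top (W := W) (fun e ↦ ⟨e, rfl⟩)).symm.le f (by simp)

end Truncated.HomotopyCategory

/-- The object of the homotopy category given by a vertex. -/
abbrev hoMk {X : SSet.{w}} (x : X _⦋0⦌) : ho X :=
  Truncated.HomotopyCategory.mk (V := (truncation 2).obj X) x

/-- The morphism of the homotopy category given by an edge. -/
abbrev Edge.hoHom {X : SSet.{w}} {x y : X _⦋0⦌} (e : Edge x y) : hoMk x ⟶ hoMk y :=
  Truncated.HomotopyCategory.homMk e.toTruncated

end SSet

/-! ### Unique factorization in path categories and length structures -/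

lemma Quiver.Path.eq_and_heq_of_comp_eq_comp {V : Type*} [Quiver V] {x y z z' : V}
    (p : Quiver.Path x z) (q : Quiver.Path z y) (p' : Quiver.Path x z') (q' : Quiver.Path z' y)
    (hp : p.length = p'.length) (h : p.comp q = p'.comp q') :
    z = z' ∧ p ≍ p' ∧ q ≍ q' := by
  have hq : q.length = q'.length := by
    have := congrArg Quiver.Path.length h
    simp only [Quiver.Path.length_comp] at this
    lia
  -- Paths grow at their end, so the common last arrows are peeled off the second factors, whose
  -- lengths agree by additivity.
  induction q with
  | nil =>
    obtain rfl := Quiver.Path.eq_of_length_zero q' hq.symm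
    obtain rfl := Quiver.Path.eq_nil_of_length_zero q' hq.symm
    exact ⟨rfl, heq_of_eq h, .rfl⟩
  | cons q e ih =>
    cases q' with
    | nil => simp at hq
    | cons q' e' =>
      simp only [Quiver.Path.comp_cons, Quiver.Path.cons.injEq] at h
      obtain ⟨rfl, h, h'⟩ := h
      obtain ⟨rfl, h₁, h₂⟩ := ih q' (eq_of_heq h) (by simpa using hq)
      obtain rfl := eq_of_heq h₁
      obtain rfl := eq_of_heq h₂
      obtain rfl := eq_of_heq h'
      exact ⟨rfl, .rfl, .rfl⟩

namespace CategoryTheory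

universe v' u'

/-- A length structure on a category: every morphism has a length, lengths are additive, only
identities have length zero, and every morphism of length at least two has a unique
factorization whose first factor has length one. The path category of a quiver has such a
structure. -/
structure LengthStructure (C : Type u) [Category.{v} C] where
  /-- the length of a morphism -/
  len {x y : C} (f : x ⟶ y) : ℕ
  len_comp {x y z : C} (f : x ⟶ y) (g : y ⟶ z) : len (f ≫ g) = len f + len g
  eq_eqToHom {x y : C} (f : x ⟶ y) (hf : len f = 0) : ∃ h : x = y, f = eqToHom h
  exists_fac {x y : C} (f : x ⟶ y) (hf : 2 ≤ len f) :
    ∃ (z : C) (g : x ⟶ z) (h : z ⟶ y), len g = 1 ∧ g ≫ h = f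
  fac_unique {x y z z' : C} (g : x ⟶ z) (h : z ⟶ y) (g' : x ⟶ z') (h' : z' ⟶ y)
    (hg : len g = 1) (hg' : len g' = 1) (fac : g ≫ h = g' ≫ h') :
    ∃ e : z = z', g ≫ eqToHom e = g' ∧ h = eqToHom e ≫ h'

namespace LengthStructure

variable {C : Type u} [Category.{v} C] {D : Type u'} [Category.{v'} D]

@[simp]
lemma len_id (L : LengthStructure C) (x : C) : L.len (𝟙 x) = 0 := by
  have := L.len_comp (𝟙 x) (𝟙 x)
  rw [Category.id_comp] at this
  lia

/-- Length structures can be pulled back along fully faithful functors which are bijective on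
objects. -/
def pullback (L : LengthStructure D) (F : C ⥤ D) [F.Full] [F.Faithful]
    (hF : Function.Bijective F.obj) : LengthStructure C where
  len f := L.len (F.map f)
  len_comp f g := by rw [F.map_comp, L.len_comp]
  eq_eqToHom {x y} f hf := by
    obtain ⟨h, h'⟩ := L.eq_eqToHom _ hf
    obtain rfl := hF.injective h
    exact ⟨rfl, F.map_injective (by simpa using h')⟩
  exists_fac {x y} f hf := by
    obtain ⟨z, g, h, hg, fac⟩ := L.exists_fac _ hf
    obtain ⟨z, rfl⟩ := hF.surjective z
    exact ⟨z, F.preimage g, F.preimage h, by simpa, F.map_injective (by simpa)⟩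
  fac_unique {x y z z'} g h g' h' hg hg' fac := by
    obtain ⟨e, h₁, h₂⟩ := L.fac_unique _ _ _ _ hg hg' (by rw [← F.map_comp, fac, F.map_comp])
    obtain rfl := hF.injective e
    exact ⟨rfl, F.map_injective (by simpa using h₁), F.map_injective (by simpa using h₂)⟩

/-- The length structure on a path category. -/
def paths (Q : Type u) [Quiver.{v} Q] : LengthStructure (Paths Q) where
  len f := Quiver.Path.length (V := Q) f
  len_comp f g := Quiver.Path.length_comp (V := Q) f g
  eq_eqToHom {x y} f hf := by
    obtain rfl : x = y := Quiver.Path.eq_of_length_zero (V := Q) f hf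
    exact ⟨rfl, Quiver.Path.eq_nil_of_length_zero (V := Q) f hf⟩
  exists_fac {x y} f hf := by
    obtain ⟨z, e, p, -, h⟩ := Quiver.Path.eq_toPath_comp_of_length_eq_succ (V := Q) f
      (n := Quiver.Path.length (V := Q) f - 1) (by lia)
    exact ⟨z, e.toPath, p, rfl, h.symm⟩
  fac_unique {x y z z'} g h g' h' hg hg' fac := by
    obtain ⟨rfl, h₁, h₂⟩ := Quiver.Path.eq_and_heq_of_comp_eq_comp (V := Q) g h g' h'
      (hg.trans hg'.symm) fac
    obtain rfl := eq_of_heq h₁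
    obtain rfl := eq_of_heq h₂
    exact ⟨rfl, by simp, by simp⟩

end LengthStructure

end CategoryTheory

/-! ### Simplices of the nerve and the coordinates of their vertices -/

namespace CategoryTheory.LengthStructure


variable {C : Type u} [Category.{v} C] (L : LengthStructure C)

section

variable {n : ℕ}

/-- The length of the morphism from the first to the `i`-th object of a sequence of composable
morphisms. -/
def coord (x : ComposableArrows C n) (i : Fin (n + 1)) : ℕ :=
  L.len (x.map (homOfLE (Fin.zero_le i)))

lemma coord_add_len (x : ComposableArrows C n) {i j : Fin (n + 1)} (f : i ⟶ j) :
    L.coord x i + L.len (x.map f) = L.coord x j := by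
  rw [coord, coord, ← L.len_comp, ← x.map_comp]
  rfl

lemma coord_mono (x : ComposableArrows C n) : Monotone (L.coord x) := fun i j hij ↦ by
  rw [← L.coord_add_len x (homOfLE hij)]
  exact Nat.le_add_right _ _

@[simp]
lemma coord_zero (x : ComposableArrows C n) : L.coord x 0 = 0 := by
  exact (congrArg L.len (x.map_id 0)).trans (L.len_id _)

lemma coord_map {m : ℕ} (f : ⦋m⦌ ⟶ ⦋n⦌) (x : ComposableArrows C n) (k : Fin (m + 1)) :
    L.coord x (f 0) + L.coord ((nerve C).map f.op x : ComposableArrows C m) k =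
      L.coord x (f k) :=
  L.coord_add_len x (homOfLE (f.toOrderHom.monotone (Fin.zero_le k)))

lemma eq_eqToHom_of_coord_eq (x : ComposableArrows C n) {i j : Fin (n + 1)} (f : i ⟶ j)
    (h : L.coord x i = L.coord x j) : ∃ e : x.obj i = x.obj j, x.map f = eqToHom e :=
  L.eq_eqToHom _ (by have := L.coord_add_len x f; lia)

lemma map_eq_map_of_le {m : ℕ} (p q : ⦋m⦌ ⟶ ⦋n⦌) (x : ComposableArrows C n)
    (hpq : ∀ k, p k ≤ q k) (h : ∀ k, L.coord x (p k) = L.coord x (q k)) :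
    (nerve C).map p.op x = (nerve C).map q.op x := by
  have h' (k : Fin (m + 1)) := L.eq_eqToHom_of_coord_eq x (homOfLE (hpq k)) (h k)
  refine CategoryTheory.Functor.ext (fun k ↦ (h' k).1) (fun k l f ↦ ?_)
  let fp : p k ⟶ p l := (SimplexCategory.toCat.map p).toFunctor.map f
  let fq : q k ⟶ q l := (SimplexCategory.toCat.map q).toFunctor.map f
  change x.map fp = eqToHom _ ≫ x.map fq ≫ eqToHom _
  -- In this commutative square the arrows from p to q have length zero, so they are identities up
  -- to transport.
  have e : x.map fp ≫ x.map (homOfLE (hpq l)) = x.map (homOfLE (hpq k)) ≫ x.map fq := by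
    rw [← x.map_comp, ← x.map_comp]
    rfl
  rw [(h' k).2, (h' l).2] at e
  exact ((comp_eqToHom_iff _ _ _).1 e).trans (Category.assoc _ _ _)

/-- Vertices with equal coordinates are joined by identities, so a simplicial operator acts on x
only through the coordinates it selects. The operators p and q need not be comparable; both are
compared with their pointwise maximum. -/
lemma map_eq_map_of_coord_eq {m : ℕ} (p q : ⦋m⦌ ⟶ ⦋n⦌) (x : ComposableArrows C n)
    (h : ∀ k, L.coord x (p k) = L.coord x (q k)) :
    (nerve C).map p.op x = (nerve C).map q.op x := by
  let r : ⦋m⦌ ⟶ ⦋n⦌ := SimplexCategory.mkHom (p.toOrderHom ⊔ q.toOrderHom)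
  have hr (k : Fin (m + 1)) : r k = p k ⊔ q k := rfl
  have hc (k : Fin (m + 1)) : L.coord x (r k) = L.coord x (p k) := by
    rw [hr, (L.coord_mono x).map_sup, ← h, sup_idem]
  rw [L.map_eq_map_of_le p r x (fun k ↦ by rw [hr]; exact le_sup_left) (fun k ↦ (hc k).symm),
    L.map_eq_map_of_le q r x (fun k ↦ by rw [hr]; exact le_sup_right)
      (fun k ↦ by rw [hc, h])]

end

section

variable {n : ℕ}

/-- A simplex of the nerve is degenerate exactly when one of its consecutive arrows is an identity,
that is, when a coordinate repeats. -/
lemma mem_nonDegenerate_iff (x : (nerve C) _⦋n⦌) :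
    x ∈ (nerve C).nonDegenerate n ↔ StrictMono (L.coord (x : ComposableArrows C n)) := by
  obtain _ | n := n
  · simpa using Subsingleton.strictMono _
  · rw [← not_iff_not, ← SSet.mem_degenerate_iff_notMem_nonDegenerate,
      Fin.strictMono_iff_lt_succ, SSet.degenerate_eq_iUnion_range_σ, Set.mem_iUnion, not_forall]
    refine exists_congr fun i ↦ ⟨?_, fun hi ↦ ⟨(nerve C).δ i.castSucc x, ?_⟩⟩
    · rintro ⟨y, rfl⟩
      have h₁ := L.coord_map (SimplexCategory.σ i) y i.castSucc
      have h₂ := L.coord_map (SimplexCategory.σ i) y i.succ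
      have h₃ : SimplexCategory.σ i i.castSucc = SimplexCategory.σ i i.succ :=
        (Fin.predAbove_castSucc_self i).trans (Fin.predAbove_succ_self i).symm
      rw [h₃, ← h₂] at h₁
      exact (Nat.add_left_cancel h₁).not_lt
    -- The composite operator moves only the vertex `i.castSucc`, sending it to `i.succ`, which here
    -- has the same coordinate.
    · have h : (nerve C).map (SimplexCategory.σ i ≫ SimplexCategory.δ i.castSucc).op x = x := by
        refine (L.map_eq_map_of_coord_eq (SimplexCategory.σ i ≫ SimplexCategory.δ i.castSucc)
          (𝟙 _) x fun k ↦ ?_).trans (by simp)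
        obtain rfl | hk := eq_or_ne k i.castSucc
        · have h₁ : i.castSucc.succAbove (i.predAbove i.castSucc) = i.succ := by simp
          refine (congrArg (L.coord x) h₁).trans (le_antisymm (not_lt.1 hi) ?_)
          exact L.coord_mono x (Fin.castSucc_lt_succ).le
        · exact congrArg (L.coord x) (Fin.succAbove_predAbove hk)
      simpa [SimplicialObject.σ, SimplicialObject.δ] using h

end

end CategoryTheory.LengthStructure

/-! ### The spine inclusion is inner anodyne -/

namespace CategoryTheory.LengthStructure


open ComposableArrows

variable {C : Type u} [Category.{v} C] (L : LengthStructure C)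

lemma coord_δ_of_ne_zero {n : ℕ} {j : Fin (n + 2)} (hj : j ≠ 0) (x : ComposableArrows C (n + 1))
    (k : Fin (n + 1)) :
    L.coord ((nerve C).δ j x : ComposableArrows C n) k = L.coord x (j.succAbove k) := by
  have h := L.coord_map (SimplexCategory.δ j) x k
  have h₀ : SimplexCategory.δ j 0 = 0 := Fin.succAbove_ne_zero_zero hj
  rw [h₀, coord_zero, zero_add] at h
  exact h

lemma coord_δ_zero {n : ℕ} (x : ComposableArrows C (n + 1)) (k : Fin (n + 1)) :
    L.coord x 1 + L.coord ((nerve C).δ 0 x : ComposableArrows C n) k = L.coord x k.succ :=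
  L.coord_map (SimplexCategory.δ 0) x k

/-- The spine of the nerve of a category with a length structure: it consists of the simplices
of total length at most one. -/
def spine : (nerve C).Subcomplex where
  obj n := { x | L.coord (x : ComposableArrows C n.unop.len) (Fin.last _) ≤ 1 }
  map {n m} f x hx := by
    have h := L.coord_map f.unop x (Fin.last _)
    have h' := L.coord_mono x (Fin.le_last (f.unop (Fin.last _)))
    have : L.coord x (Fin.last _) ≤ 1 := hx
    exact (Nat.le_add_left _ _).trans (h.le.trans (h'.trans this))

lemma mem_spine_iff {n : ℕ} (x : (nerve C) _⦋n⦌) :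
    x ∈ L.spine.obj (op ⦋n⦌) ↔ L.coord (x : ComposableArrows C n) (Fin.last _) ≤ 1 := Iff.rfl

lemma δ_one_precomp_precomp {n : ℕ} (F : ComposableArrows C n) {X Y : C} (g : X ⟶ Y)
    (h : Y ⟶ F.left) :
    (nerve C).δ 1 ((F.precomp h).precomp g) = F.precomp (g ≫ h) :=
  ext_succ rfl rfl (show g ≫ h = 𝟙 _ ≫ (g ≫ h) ≫ 𝟙 _ by simp)

lemma precomp_injective {n : ℕ} {F F' : ComposableArrows C n} {X X' : C} {f : X ⟶ F.left}
    {f' : X' ⟶ F'.left} (h : F.precomp f = F'.precomp f') :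
    ∃ (hF : F = F') (hX : X = X'), f = eqToHom hX ≫ f' ≫ eqToHom (by rw [hF]) := by
  obtain rfl : F = F' := congrArg ComposableArrows.δ₀ h
  obtain rfl : X = X' := Functor.congr_obj h 0
  have := Functor.congr_hom h (homOfLE (Fin.zero_le (1 : Fin (n + 2))))
  exact ⟨rfl, rfl, this⟩

/-- Splitting the first generator off the first arrow inserts a new vertex, which the face 1 removes
again. -/
lemma exists_δ_one_eq {n : ℕ} (y : (nerve C) _⦋n + 1⦌)
    (hy : 2 ≤ L.coord (y : ComposableArrows C (n + 1)) 1) :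
    ∃ (x : (nerve C) _⦋n + 2⦌), L.coord (x : ComposableArrows C (n + 2)) 1 = 1 ∧
      (nerve C).δ 1 x = y := by
  obtain ⟨F, X, f, rfl⟩ := ComposableArrows.precomp_surjective (y : ComposableArrows C (n + 1))
  obtain ⟨Y, g, h, hg, rfl⟩ := L.exists_fac f hy
  exact ⟨(F.precomp h).precomp g, hg, δ_one_precomp_precomp _ _ _⟩

/-- The face 1 composes the first two arrows; the factor of length one can be recovered from the
composite by unique factorization. -/
lemma eq_of_δ_one_eq {n : ℕ} {x x' : (nerve C) _⦋n + 2⦌}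
    (hx : L.coord (x : ComposableArrows C (n + 2)) 1 = 1)
    (hx' : L.coord (x' : ComposableArrows C (n + 2)) 1 = 1)
    (h : (nerve C).δ 1 x = (nerve C).δ 1 x') : x = x' := by
  obtain ⟨F, X, g, rfl⟩ := ComposableArrows.precomp_surjective (x : ComposableArrows C (n + 2))
  obtain ⟨F, Y, h₀, rfl⟩ := ComposableArrows.precomp_surjective F
  obtain ⟨F', X', g', rfl⟩ := ComposableArrows.precomp_surjective (x' : ComposableArrows C (n + 2))
  obtain ⟨F', Y', h₀', rfl⟩ := ComposableArrows.precomp_surjective F'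
  erw [δ_one_precomp_precomp, δ_one_precomp_precomp] at h
  obtain ⟨rfl, rfl, fac⟩ := precomp_injective h
  obtain ⟨e, h₁, h₂⟩ := L.fac_unique (z := Y) (z' := Y') g h₀ g' h₀' hx hx'
    (fac.trans ((Category.id_comp _).trans (Category.comp_id _)))
  subst e
  obtain rfl : g = g' := (Category.comp_id _).symm.trans h₁
  obtain rfl : h₀ = h₀' := h₂.trans (Category.id_comp _)
  rfl

end CategoryTheory.LengthStructure

namespace CategoryTheory.LengthStructure


variable {C : Type u} [Category.{v} C] (L : LengthStructure C)

section

variable {n : ℕ} {x : ComposableArrows C (n + 2)}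

lemma coord_δ_one_one : L.coord ((nerve C).δ 1 x : ComposableArrows C (n + 1)) 1 = L.coord x 2 :=
  L.coord_δ_of_ne_zero (by simp) x 1

lemma coord_δ_last {n : ℕ} {j : Fin (n + 2)} (hj : j ≠ 0) (hj' : j ≠ Fin.last _)
    (x : ComposableArrows C (n + 1)) :
    L.coord ((nerve C).δ j x : ComposableArrows C n) (Fin.last _) = L.coord x (Fin.last _) := by
  rw [L.coord_δ_of_ne_zero hj, Fin.succAbove_ne_last_last hj']

lemma one_lt_coord_two (h : StrictMono (L.coord x)) (h₁ : L.coord x 1 = 1) : 1 < L.coord x 2 := by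
  exact h₁.symm.trans_lt (h (Fin.lt_def.2 (Nat.lt_succ_self 1)))

lemma strictMono_coord_δ_one (h : StrictMono (L.coord x)) :
    StrictMono (L.coord ((nerve C).δ 1 x : ComposableArrows C (n + 1))) := fun i j hij ↦ by
  rw [L.coord_δ_of_ne_zero (by simp), L.coord_δ_of_ne_zero (by simp)]
  exact h (Fin.strictMono_succAbove _ hij)

lemma one_lt_coord_last (h : StrictMono (L.coord x)) (h₁ : L.coord x 1 = 1) :
    1 < L.coord x (Fin.last _) :=
  (L.one_lt_coord_two h h₁).trans_le (L.coord_mono x (Fin.le_last 2))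

lemma strictMono_coord_of_δ_one
    (h : StrictMono (L.coord ((nerve C).δ 1 x : ComposableArrows C (n + 1))))
    (h₁ : L.coord x 1 = 1)
    (h₂ : 1 < L.coord ((nerve C).δ 1 x : ComposableArrows C (n + 1)) 1) :
    StrictMono (L.coord x) := by
  refine Fin.strictMono_iff_lt_succ.2 fun i ↦ ?_
  obtain rfl | ⟨i, rfl⟩ := i.eq_zero_or_eq_succ
  · rw [Fin.castSucc_zero, coord_zero, Fin.succ_zero_eq_one, h₁]
    exact Nat.one_pos
  obtain rfl | ⟨i, rfl⟩ := i.eq_zero_or_eq_succ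
  · refine lt_of_eq_of_lt h₁ (h₂.trans_eq L.coord_δ_one_one)
  · have := h (Fin.castSucc_lt_succ (i := i.succ))
    rw [L.coord_δ_of_ne_zero (by simp), L.coord_δ_of_ne_zero (by simp)] at this
    exact this

end

/-- The pairing which shows that the spine inclusion is inner anodyne: the simplices of type (I)
are those whose first arrow is of length one. -/
def pairingCore : L.spine.PairingCore where
  ι := Σ (n : ℕ), { x : (nerve C) _⦋n + 2⦌ // StrictMono (L.coord (n := n + 2) x) ∧
    L.coord (n := n + 2) x 1 = 1 }
  dim s := s.1 + 1
  simplex s := s.2.1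
  index _ := 1
  nonDegenerate₁ s := (L.mem_nonDegenerate_iff _).2 s.2.2.1
  nonDegenerate₂ s := (L.mem_nonDegenerate_iff _).2 (L.strictMono_coord_δ_one s.2.2.1)
  notMem₁ s hs := (L.one_lt_coord_last s.2.2.1 s.2.2.2).not_ge hs
  notMem₂ s hs := (L.one_lt_coord_last s.2.2.1 s.2.2.2).not_ge
    ((L.coord_δ_last (by simp) (by simp [Fin.ext_iff]) _).symm.trans_le hs)
  injective_type₁' := by
    rintro ⟨n, x, h, h₁⟩ ⟨m, y, h', h₁'⟩ eq
    obtain rfl : n = m := by simpa using SSet.S.dim_eq_of_mk_eq eq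
    obtain rfl := (SSet.S.ext_iff _ _).1 eq
    rfl
  injective_type₂' := by
    rintro ⟨n, x, h, h₁⟩ ⟨m, y, h', h₁'⟩ eq
    obtain rfl : n = m := by simpa using SSet.S.dim_eq_of_mk_eq eq
    obtain rfl := L.eq_of_δ_one_eq h₁ h₁' ((SSet.S.ext_iff _ _).1 eq)
    rfl
  type₁_ne_type₂' := by
    rintro ⟨n, x, h, h₁⟩ ⟨m, y, h', h₁'⟩ eq
    obtain rfl : m = n + 1 := by simpa using (SSet.S.dim_eq_of_mk_eq eq).symm
    obtain rfl := (SSet.S.ext_iff _ _).1 eq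
    exact (L.one_lt_coord_two h' h₁').ne (L.coord_δ_one_one.symm.trans h₁).symm
  surjective' x := by
    obtain ⟨n, x, hx, hx', rfl⟩ := SSet.Subcomplex.N.mk_surjective x
    rw [mem_nonDegenerate_iff] at hx
    rw [mem_spine_iff, not_le] at hx'
    obtain _ | n := n
    · exact (Nat.not_lt_zero 1 (hx'.trans_eq (L.coord_zero (n := 0) x))).elim
    have h₁ : 0 < L.coord (n := n + 1) x 1 :=
      lt_of_eq_of_lt (L.coord_zero x).symm (hx Fin.zero_lt_one)
    -- A first arrow of length one gives type (I), since a single edge of length one would lie in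
    -- the spine. A longer first arrow splits, which exhibits the simplex as the face 1 of one of
    -- type (I).
    obtain h₁ | h₁ := (Nat.succ_le_iff.2 h₁).eq_or_lt
    · obtain _ | n := n
      · exact (hx'.ne h₁).elim
      · exact ⟨⟨n, x, hx, h₁.symm⟩, Or.inl rfl⟩
    · obtain ⟨y, hy, rfl⟩ := L.exists_δ_one_eq x h₁
      exact ⟨⟨n, y, L.strictMono_coord_of_δ_one hx hy h₁, hy⟩, Or.inr rfl⟩

/-- A face with index at least two keeps the first arrow, of length one, whereas a simplex of type
(II) has a longer first arrow. -/
lemma eq_one_of_δ_eq {n : ℕ} {j : Fin (n + 3)} {x y : (nerve C) _⦋n + 2⦌}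
    (hx : StrictMono (L.coord (n := n + 2) x)) (hx₁ : L.coord (n := n + 2) x 1 = 1)
    (hy₁ : L.coord (n := n + 2) y 1 = 1) (hj : j ≠ 0)
    (h : (nerve C).δ j y = (nerve C).δ 1 x) : j = 1 := by
  by_contra hj'
  have h₁ := L.coord_δ_of_ne_zero hj y 1
  have h₂ : j.succAbove 1 = 1 := by
    refine Fin.succAbove_of_castSucc_lt _ 1 (Fin.lt_def.2 ?_)
    have h₃ : j.val ≠ 0 := fun h ↦ hj (Fin.ext h)
    have h₄ : j.val ≠ 1 := fun h ↦ hj' (Fin.ext h)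
    change 1 < j.val
    lia
  rw [h, h₂, hy₁] at h₁
  exact (L.one_lt_coord_two hx hx₁).ne (h₁.symm.trans L.coord_δ_one_one)

/-- The face 0 discards an arrow of length one, while the face 1 preserves total length. This strict
drop makes the total length a rank function. -/
lemma coord_last_lt_of_δ_zero_eq {n : ℕ} {x y : (nerve C) _⦋n + 2⦌}
    (hy₁ : L.coord (n := n + 2) y 1 = 1)
    (h : (nerve C).δ 0 y = (nerve C).δ 1 x) :
    L.coord (n := n + 2) x (Fin.last _) < L.coord (n := n + 2) y (Fin.last _) := by
  have h₁ := L.coord_δ_zero y (Fin.last _)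
  have h₂ := L.coord_δ_last (j := 1) (by simp) (by simp [Fin.ext_iff]) x
  rw [h, h₂, hy₁] at h₁
  exact (Nat.lt_one_add_iff.2 le_rfl).trans_eq h₁

instance : L.pairingCore.IsInner where
  ne_zero s := (Fin.zero_lt_one (n := s.1 + 1)).ne'
  ne_last s := ne_of_lt (Fin.lt_def.2 (Nat.succ_lt_succ (Nat.succ_pos s.1)))

instance : L.pairingCore.IsProper where
  isUniquelyCodimOneFace := by
    rintro ⟨n, x, h, h₁⟩
    refine (SSet.S.IsUniquelyCodimOneFace.iff _ _).2 ⟨1, rfl, fun j hj ↦ ?_⟩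
    by_cases hj₀ : j = 0
    · subst hj₀
      exact (L.coord_last_lt_of_δ_zero_eq h₁ hj).ne rfl |>.elim
    · exact L.eq_one_of_δ_eq h h₁ h₁ hj₀ hj

/-- The rank function for `pairingCore`, given by the total length. -/
def weakRankFunction : L.pairingCore.WeakRankFunction ℕ where
  rank s := L.coord (n := s.1 + 2) s.2.1 (Fin.last _)
  lt := by
    rintro ⟨n, x, h, h₁⟩ ⟨m, y, h', h₁'⟩ ⟨ne, hlt⟩ hdim
    obtain rfl : n = m := by simpa [pairingCore] using hdim
    obtain ⟨f, hf, eq⟩ := SSet.N.le_iff_exists_mono.1 (SSet.Subcomplex.N.lt_iff.1 hlt).le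
    replace hf : Mono (C := SimplexCategory) (X := ⦋n + 1⦌) (Y := ⦋n + 2⦌) f := hf
    obtain ⟨j, rfl⟩ := SimplexCategory.eq_δ_of_mono (n := n + 1) f
    by_cases hj₀ : j = 0
    · subst hj₀
      exact L.coord_last_lt_of_δ_zero_eq h₁' eq
    -- Apart from the face 0, only the face paired with y itself is of type (II), so x and y would
    -- coincide.
    · obtain rfl := L.eq_one_of_δ_eq h h₁ h₁' hj₀ eq
      obtain rfl := L.eq_of_δ_one_eq h₁ h₁' eq.symm
      exact (ne rfl).elim

instance : L.pairingCore.IsRegular := L.weakRankFunction.isRegular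

lemma innerAnodyneExtensions_spine_ι :
    SSet.innerAnodyneExtensions L.spine.ι :=
  L.pairingCore.pairing.innerAnodyneExtensions

end CategoryTheory.LengthStructure

lemma SSet.app_map_eq {A S : SSet.{u}} {f g : A ⟶ S} {n m : SimplexCategoryᵒᵖ} (α : n ⟶ m)
    {z : A.obj n} (h : f.app n z = g.app n z) : f.app m (A.map α z) = g.app m (A.map α z) := by
  rw [NatTrans.naturality_apply, NatTrans.naturality_apply, h]

/-! ### Maps out of the spine -/

namespace CategoryTheory.LengthStructure

variable {C : Type u} [Category.{v} C] (L : LengthStructure C)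

/-- The map `⦋n⦌ ⟶ ⦋1⦌` which sends to `0` the indices of coordinate zero. -/
def char {n : ℕ} (x : ComposableArrows C n) : ⦋n⦌ ⟶ ⦋1⦌ :=
  SimplexCategory.mkHom
    { toFun k := if L.coord x k = 0 then 0 else 1
      monotone' i j hij := by
        have := L.coord_mono x hij
        dsimp only
        split_ifs
        · rfl
        · exact Fin.zero_le _
        · lia
        · rfl }

lemma char_of_coord_eq_zero {n : ℕ} {x : ComposableArrows C n} {k : Fin (n + 1)}
    (h : L.coord x k = 0) : L.char x k = 0 := if_pos h

lemma char_of_coord_ne_zero {n : ℕ} {x : ComposableArrows C n} {k : Fin (n + 1)}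
    (h : L.coord x k ≠ 0) : L.char x k = 1 := if_neg h

lemma hom_ext_one {m : ℕ} {f g : ⦋1⦌ ⟶ ⦋m⦌} (h₀ : f 0 = g 0) (h₁ : f 1 = g 1) : f = g := by
  ext k : 3
  fin_cases k
  · exact h₀
  · exact h₁

/-- Coordinates in the spine are 0 or 1, so each simplex is recovered from its edge between first
and last vertex. Hence the spine is determined by its edges. -/
lemma map_char_comp {n : ℕ} (x : (nerve C) _⦋n⦌)
    (hx : L.coord (n := n) x (Fin.last n) ≤ 1) :
    (nerve C).map (L.char x).op
      ((nerve C).map (SimplexCategory.mkOfLe 0 (Fin.last n) (Fin.zero_le _)).op x) = x := by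
  have := L.map_eq_map_of_coord_eq
    (L.char x ≫ SimplexCategory.mkOfLe 0 (Fin.last n) (Fin.zero_le _)) (𝟙 _) x fun k ↦ by
      have h := L.coord_mono x (Fin.le_last k)
      by_cases hk : L.coord x k = 0
      · refine (congrArg (fun l ↦ L.coord x (SimplexCategory.mkOfLe 0 (Fin.last n)
          (Fin.zero_le _) l)) (L.char_of_coord_eq_zero hk)).trans ?_
        exact (L.coord_zero x).trans hk.symm
      · refine (congrArg (fun l ↦ L.coord x (SimplexCategory.mkOfLe 0 (Fin.last n)
          (Fin.zero_le _) l)) (L.char_of_coord_ne_zero hk)).trans ?_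
        change L.coord x (Fin.last n) = L.coord x k
        lia
  simpa using this

variable {S : SSet.{max u v}} (vert : C → S _⦋0⦌)
  (edge : ∀ {x y : C} (f : x ⟶ y), L.len f = 1 → SSet.Edge (vert x) (vert y))

/-- The edge attached to a morphism: the given edge if its length is one, and a degenerate
edge otherwise. -/
def extEdge {x y : C} (f : x ⟶ y) : S _⦋1⦌ :=
  if h : L.len f = 1 then (edge f h).edge else S.σ 0 (vert x)

lemma extEdge_of_len_eq_one {x y : C} (f : x ⟶ y) (h : L.len f = 1) :
    L.extEdge vert edge f = (edge f h).edge := dif_pos h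

lemma extEdge_of_len_eq_zero {x y : C} (f : x ⟶ y) (h : L.len f = 0) :
    L.extEdge vert edge f = S.σ 0 (vert x) := dif_neg (by lia)

lemma extEdge_congr {x y x' y' : C} {f : x ⟶ y} {f' : x' ⟶ y'}
    (h : Arrow.mk f = Arrow.mk f') :
    L.extEdge vert edge f = L.extEdge vert edge f' := by
  obtain ⟨rfl, rfl, h⟩ := (Arrow.mk_eq_mk_iff _ _).1 h
  obtain rfl : f = f' := by simpa using h
  rfl

lemma δ_one_extEdge {x y : C} (f : x ⟶ y) (h : L.len f ≤ 1) :
    S.δ 1 (L.extEdge vert edge f) = vert x := by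
  obtain h | h := Nat.le_one_iff_eq_zero_or_eq_one.1 h
  · rw [L.extEdge_of_len_eq_zero _ _ _ h]
    exact S.δ_comp_σ_succ_apply (i := 0) _
  · rw [L.extEdge_of_len_eq_one _ _ _ h, (edge f h).src_eq]

lemma δ_zero_extEdge {x y : C} (f : x ⟶ y) (h : L.len f ≤ 1) :
    S.δ 0 (L.extEdge vert edge f) = vert y := by
  obtain h | h := Nat.le_one_iff_eq_zero_or_eq_one.1 h
  · rw [L.extEdge_of_len_eq_zero _ _ _ h, ← (L.eq_eqToHom f h).1]
    exact S.δ_comp_σ_self_apply (i := 0) _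
  · rw [L.extEdge_of_len_eq_one _ _ _ h, (edge f h).tgt_eq]

/-- Three cases: if i and j both have coordinate 0 the result is degenerate on the source of the
long edge, if both have coordinate 1 it is degenerate on the target, and otherwise it is the long
edge up to identities. -/
lemma extEdge_map {n : ℕ} (x : ComposableArrows C n) (hx : L.coord x (Fin.last n) ≤ 1)
    {i j : Fin (n + 1)} (f : i ⟶ j) :
    L.extEdge vert edge (x.map f) =
      S.map (SimplexCategory.mkOfLe i j (leOfHom f) ≫ L.char x).op
        (L.extEdge vert edge (x.map (homOfLE (Fin.zero_le (Fin.last n))))) := by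
  have h₁ := L.coord_add_len x f
  have h₂ := L.coord_mono x (Fin.le_last j)
  by_cases hj : L.coord x j = 0
  · have hi : L.coord x i = 0 := by lia
    have eq : SimplexCategory.mkOfLe i j (leOfHom f) ≫ L.char x =
        SimplexCategory.σ 0 ≫ SimplexCategory.δ 1 :=
      hom_ext_one (L.char_of_coord_eq_zero hi) (L.char_of_coord_eq_zero hj)
    rw [L.extEdge_of_len_eq_zero _ _ _ (by lia), eq, op_comp, Functor.map_comp_apply]
    refine congrArg (S.σ 0) ?_
    exact (congrArg vert (L.eq_eqToHom_of_coord_eq x (homOfLE (Fin.zero_le i))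
      ((L.coord_zero x).trans hi.symm)).1.symm).trans (L.δ_one_extEdge vert edge _ hx).symm
  · by_cases hi : L.coord x i = 0
    · have eq : SimplexCategory.mkOfLe i j (leOfHom f) ≫ L.char x = 𝟙 _ :=
        hom_ext_one (L.char_of_coord_eq_zero hi) (L.char_of_coord_ne_zero hj)
      rw [eq, op_id, Functor.map_id_apply]
      refine L.extEdge_congr _ _ ((Arrow.mk_eq_mk_iff _ _).2 ?_)
      obtain ⟨e, he⟩ := L.eq_eqToHom_of_coord_eq x (homOfLE (Fin.zero_le i))
        ((L.coord_zero x).trans hi.symm)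
      obtain ⟨e', he'⟩ := L.eq_eqToHom_of_coord_eq x (homOfLE (Fin.le_last j)) (by lia)
      refine ⟨e.symm, e', ?_⟩
      have : x.map (homOfLE (Fin.zero_le (Fin.last n))) =
        x.map (homOfLE (Fin.zero_le i)) ≫ x.map f ≫ x.map (homOfLE (Fin.le_last j)) := by
          rw [← x.map_comp, ← x.map_comp]
          rfl
      rw [this, he, he']
      simp
    · have eq : SimplexCategory.mkOfLe i j (leOfHom f) ≫ L.char x =
          SimplexCategory.σ 0 ≫ SimplexCategory.δ 0 :=
        hom_ext_one (L.char_of_coord_ne_zero hi) (L.char_of_coord_ne_zero hj)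
      rw [L.extEdge_of_len_eq_zero _ _ _ (by lia), eq, op_comp, Functor.map_comp_apply]
      refine congrArg (S.σ 0) ?_
      exact (congrArg vert (L.eq_eqToHom_of_coord_eq x (homOfLE (Fin.le_last i))
        (by lia)).1).trans (L.δ_zero_extEdge vert edge _ hx).symm

/-- This is the identity of operators behind the naturality of `spineDesc`: a vertex of the
restricted simplex has the coordinate of either its first or its last vertex. -/
lemma char_map_comp {n m : ℕ} (x : ComposableArrows C n) (hx : L.coord x (Fin.last n) ≤ 1)
    (α : ⦋m⦌ ⟶ ⦋n⦌) :
    L.char ((nerve C).map α.op x) ≫ SimplexCategory.mkOfLe (α 0) (α (Fin.last m))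
      (α.toOrderHom.monotone (Fin.zero_le _)) ≫ L.char x = α ≫ L.char x := by
  ext k : 3
  have h₁ := L.coord_map α x k
  have h₂ := (L.coord_mono x (Fin.le_last (α k))).trans hx
  by_cases hk : L.coord ((nerve C).map α.op x : ComposableArrows C m) k = 0
  · refine (congrArg (fun l ↦ L.char x (SimplexCategory.mkOfLe (α 0) (α (Fin.last m))
      (α.toOrderHom.monotone (Fin.zero_le _)) l)) (L.char_of_coord_eq_zero hk)).trans ?_
    change L.char x (α 0) = L.char x (α k)
    change (if L.coord x (α 0) = 0 then (0 : Fin 2) else 1) = (if L.coord x (α k) = 0 then 0 else 1)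
    rw [← h₁, hk, add_zero]
  · refine (congrArg (fun l ↦ L.char x (SimplexCategory.mkOfLe (α 0) (α (Fin.last m))
      (α.toOrderHom.monotone (Fin.zero_le _)) l)) (L.char_of_coord_ne_zero hk)).trans ?_
    change L.char x (α (Fin.last m)) = L.char x (α k)
    have h₃ := L.coord_mono x (α.toOrderHom.monotone (Fin.le_last k))
    have h₄ : L.coord x (α k) ≠ 0 := by lia
    rw [L.char_of_coord_ne_zero h₄, L.char_of_coord_ne_zero]
    exact fun h ↦ h₄ (Nat.le_zero.1 (h₃.trans_eq h))

/-- The map from the spine given by vertices and by edges for the morphisms of length one. -/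
def spineDesc (L : LengthStructure C) {S : SSet.{max u v}} (vert : C → S _⦋0⦌)
    (edge : ∀ {x y : C} (f : x ⟶ y), L.len f = 1 → SSet.Edge (vert x) (vert y)) :
    L.spine.toSSet ⟶ S where
  app n := ↾fun x ↦ S.map (L.char (n := n.unop.len) x.1).op (L.extEdge vert edge
    (Functor.map (C := Fin (n.unop.len + 1)) x.1 (homOfLE (Fin.zero_le (Fin.last n.unop.len)))))
  naturality n m α := by
    ext ⟨x, hx⟩
    obtain ⟨⟨n⟩⟩ := n
    obtain ⟨⟨m⟩⟩ := m
    obtain ⟨α, rfl⟩ := α.op_surjective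
    have h₁ := L.extEdge_map vert edge (x : ComposableArrows C n) hx
      (homOfLE (α.toOrderHom.monotone (Fin.zero_le (Fin.last m))))
    change S.map (L.char ((nerve C).map α.op x)).op _ = S.map α.op (S.map _ _)
    refine (congrArg (S.map _) h₁).trans ?_
    rw [← Functor.map_comp_apply, ← Functor.map_comp_apply, ← op_comp, ← op_comp]
    exact congrArg (fun β ↦ S.map (Quiver.Hom.op β) _) (L.char_map_comp x hx α)

lemma spineDesc_app_zero (x : L.spine.toSSet _⦋0⦌) :
    (L.spineDesc vert edge).app _ x = vert (Functor.obj (C := Fin 1) x.1 0) := by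
  have h : L.len (Functor.map (C := Fin 1) x.1 (homOfLE (Fin.zero_le (Fin.last 0)))) = 0 :=
    L.coord_zero (n := 0) x.1
  change S.map (L.char (n := 0) x.1).op (L.extEdge vert edge (Functor.map (C := Fin 1) x.1
    (homOfLE (Fin.zero_le (Fin.last 0))))) = _
  rw [extEdge_of_len_eq_zero _ _ _ _ h]
  refine (S.map_comp_apply _ _ _).symm.trans ?_
  have h : L.char (n := 0) x.1 ≫ SimplexCategory.σ 0 = 𝟙 ⦋0⦌ := by
    ext k : 3
    exact Subsingleton.elim (α := Fin 1) _ _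
  exact (congrArg (fun β ↦ S.map (Quiver.Hom.op β) _) h).trans (S.map_id_apply _ _)

lemma spineDesc_app_one (x : L.spine.toSSet _⦋1⦌)
    (hx : L.len (Functor.map (C := Fin 2) x.1 (homOfLE (Fin.zero_le 1))) = 1) :
    (L.spineDesc vert edge).app _ x = (edge _ hx).edge := by
  change S.map (L.char (n := 1) x.1).op (L.extEdge vert edge (Functor.map (C := Fin 2) x.1
    (homOfLE (Fin.zero_le (Fin.last 1))))) = _
  have h : L.char (n := 1) x.1 = 𝟙 _ := hom_ext_one (L.char_of_coord_eq_zero (L.coord_zero _))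
    (L.char_of_coord_ne_zero (by
      have : L.coord (n := 1) x.1 1 = 1 := hx
      rw [this]
      exact Nat.one_ne_zero))
  rw [h, op_id, Functor.map_id_apply]
  exact L.extEdge_of_len_eq_one _ _ _ hx

/-- Edges of length zero are degenerate, and all other simplices come from edges by `map_char_comp`.
-/
lemma spine_hom_ext {f g : L.spine.toSSet ⟶ S}
    (h₀ : ∀ x : L.spine.toSSet _⦋0⦌, f.app _ x = g.app _ x)
    (h₁ : ∀ x : L.spine.toSSet _⦋1⦌, L.coord (n := 1) x.1 1 = 1 → f.app _ x = g.app _ x) :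
    f = g := by
  have h₁' (x : L.spine.toSSet _⦋1⦌) : f.app _ x = g.app _ x := by
    by_cases hx : L.coord (n := 1) x.1 1 = 1
    · exact h₁ x hx
    · have hx' := (L.mem_spine_iff _).1 x.2
      have hx₀ : L.coord (n := 1) x.1 1 = 0 := by
        change L.coord (n := 1) x.1 1 ≤ 1 at hx'
        lia
      have : (L.spine.toSSet).σ 0 ((L.spine.toSSet).δ 1 x) = x := by
        refine Subtype.ext ?_
        refine Eq.trans ?_ ((L.map_eq_map_of_coord_eq (SimplexCategory.σ 0 ≫ SimplexCategory.δ 1) (𝟙 ⦋1⦌) x.1 (by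
          intro k
          fin_cases k
          · rfl
          · exact (L.coord_zero _).trans hx₀.symm)).trans ((nerve C).map_id_apply _ _))
        exact ((nerve C).map_comp_apply _ _ _).symm
      have h := SSet.app_map_eq (SimplexCategory.σ (0 : Fin 1)).op (h₀ (L.spine.toSSet.δ 1 x))
      exact (congrArg (f.app (op ⦋1⦌)) this).symm.trans (h.trans (congrArg (g.app (op ⦋1⦌)) this))
  ext ⟨⟨n⟩⟩ x
  have : L.spine.toSSet.map (L.char (n := n) x.1).op (L.spine.toSSet.map
      (SimplexCategory.mkOfLe 0 (Fin.last n) (Fin.zero_le _)).op x) = x :=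
    Subtype.ext (L.map_char_comp x.1 x.2)
  exact (congrArg (f.app _) this).symm.trans ((SSet.app_map_eq _ (h₁' _)).trans
    (congrArg (g.app _) this))

end CategoryTheory.LengthStructure

/-! ### Exponentials as inner fibrations, and squares made of two triangles -/

namespace SSet

variable (Y : SSet.{u})

/-- Identifying restriction with the internal hom makes the stability of quasi-categories and inner
fibrations under exponentiation available for `expo`. -/
lemma pre_app_eq_precomp {K L : SSet.{u}} (i : K ⟶ L) :
    (MonoidalClosed.pre i).app Y = precomp Y i := by
  let g : (ihom L).obj Y ⟶ (ihom K).obj Y := precomp Y i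
  change _ = g
  apply MonoidalClosed.uncurry_injective
  rw [MonoidalClosed.uncurry_pre, MonoidalClosed.uncurry_eq]
  ext n ⟨x, y⟩
  rfl

instance [Quasicategory Y] (K : SSet.{u}) : Quasicategory (expo Y K) :=
  inferInstanceAs (Quasicategory ((ihom K).obj Y))

instance [Quasicategory Y] {K L : SSet.{u}} (i : K ⟶ L) [Mono i] :
    InnerFibration (precomp Y i) := by
  rw [← pre_app_eq_precomp]
  exact inferInstanceAs (InnerFibration ((MonoidalClosed.pre i).app Y))

lemma innerAnodyneExtensions.exists_lift {A B E D : SSet.{u}} {i : A ⟶ B}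
    (hi : innerAnodyneExtensions i) (p : E ⟶ D) [InnerFibration p] (f : A ⟶ E) (g : B ⟶ D)
    (w : f ≫ p = i ≫ g) : ∃ l : B ⟶ E, i ≫ l = f ∧ l ≫ p = g := by
  have := hi p ((innerFibration_iff p).1 inferInstance)
  have sq : CommSq f i p g := ⟨w⟩
  exact ⟨sq.lift, sq.fac_left, sq.fac_right⟩

lemma innerAnodyneExtensions.exists_extension {A B : SSet.{u}} {i : A ⟶ B}
    (hi : innerAnodyneExtensions i) {Y : SSet.{u}} [Quasicategory Y] (f : A ⟶ Y) :
    ∃ l : B ⟶ Y, i ≫ l = f := by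
  obtain ⟨l, h, -⟩ := hi.exists_lift (Limits.terminal.from Y) f (Limits.terminal.from B)
    (Subsingleton.elim _ _)
  exact ⟨l, h⟩

/-- The sum of two maps to `⦋1⦌`. -/
def addHom {d : SimplexCategory} (a t : d ⟶ ⦋1⦌) : d ⟶ ⦋2⦌ :=
  SimplexCategory.Hom.mk
    { toFun k := ⟨(a.toOrderHom k).val + (t.toOrderHom k).val, by lia⟩
      monotone' i j hij := by
        have h₁ := Fin.le_def.1 (a.toOrderHom.monotone hij)
        have h₂ := Fin.le_def.1 (t.toOrderHom.monotone hij)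
        exact Fin.le_def.2 (Nat.add_le_add h₁ h₂) }

lemma comp_addHom {d d' : SimplexCategory} (φ : d' ⟶ d) (a t : d ⟶ ⦋1⦌) :
    φ ≫ addHom a t = addHom (φ ≫ a) (φ ≫ t) := rfl

lemma hom_eq_of_le {d : SimplexCategory} {a t : d ⟶ ⦋1⦌} (h : ∀ k, a.toOrderHom k ≤ t.toOrderHom k)
    (h' : ∀ k, t.toOrderHom k ≤ a.toOrderHom k) : a = t := by
  ext k : 3
  exact le_antisymm (h k) (h' k)

lemma addHom_self {d : SimplexCategory} (a : d ⟶ ⦋1⦌) :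
    addHom a a = a ≫ SimplexCategory.δ 1 := by
  ext k : 3
  have h : ∀ b : Fin 2, b.val + b.val = (Fin.succAbove (1 : Fin 3) b).val := by decide
  exact Fin.ext (h (a.toOrderHom k))

lemma addHom_of_eq_zero {d : SimplexCategory} (a t : d ⟶ ⦋1⦌)
    (h : ∀ k, a.toOrderHom k = 0) : addHom a t = t ≫ SimplexCategory.δ 2 := by
  ext k : 3
  have h' : ∀ b : Fin 2, 0 + b.val = (Fin.succAbove (2 : Fin 3) b).val := by decide
  exact Fin.ext ((congrArg (fun b : Fin 2 ↦ b.val + _) (h k)).trans (h' (t.toOrderHom k)))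

lemma addHom_of_eq_one {d : SimplexCategory} (a t : d ⟶ ⦋1⦌)
    (h : ∀ k, a.toOrderHom k = 1) : addHom a t = t ≫ SimplexCategory.δ 0 := by
  ext k : 3
  have h' : ∀ b : Fin 2, 1 + b.val = (Fin.succAbove (0 : Fin 3) b).val := by decide
  exact Fin.ext ((congrArg (fun b : Fin 2 ↦ b.val + _) (h k)).trans (h' (t.toOrderHom k)))

lemma addHom_comm {d : SimplexCategory} (a t : d ⟶ ⦋1⦌) : addHom a t = addHom t a := by
  ext k : 3
  exact Fin.ext (Nat.add_comm _ _)

/-- Monotone maps to ⦋1⦌ correspond to final segments of a chain, so any two are comparable. Thus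
the triangles a ≤ t and t ≤ a cover Δ[1] × Δ[1]. -/
lemma le_of_not_le {d : SimplexCategory} {a t : d ⟶ ⦋1⦌}
    (h : ¬ ∀ k, a.toOrderHom k ≤ t.toOrderHom k) (k : Fin (d.len + 1)) :
    t.toOrderHom k ≤ a.toOrderHom k := by
  push Not at h
  obtain ⟨l, hl⟩ := h
  obtain hkl | hkl := le_total k l
  · have := t.toOrderHom.monotone hkl
    lia
  · have := a.toOrderHom.monotone hkl
    lia

open Classical in
/-- The maps `(a, t) : Δ[d] ⟶ Δ[1] × Δ[1]` are evaluated using two `2`-simplices which form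
a commutative square. -/
noncomputable def squareApp {Y : SSet.{u}} (s₁ s₂ : Y _⦋2⦌) {d : SimplexCategory} (a t : d ⟶ ⦋1⦌) :
    Y.obj (op d) :=
  if ∀ k, a.toOrderHom k ≤ t.toOrderHom k then Y.map (addHom a t).op s₁ else
    Y.map (addHom a t).op s₂

section

variable {Y} {s₁ s₂ : Y _⦋2⦌} {d d' : SimplexCategory} (a t : d ⟶ ⦋1⦌)

lemma squareApp_of_le (h : ∀ k, a.toOrderHom k ≤ t.toOrderHom k) :
    squareApp s₁ s₂ a t = Y.map (addHom a t).op s₁ := if_pos h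

/-- The triangles overlap where a = t. There the sum factors through the face 1, so a common
diagonal is exactly the gluing condition. -/
lemma squareApp_of_ge (hs : Y.δ 1 s₁ = Y.δ 1 s₂) (h : ∀ k, t.toOrderHom k ≤ a.toOrderHom k) :
    squareApp s₁ s₂ a t = Y.map (addHom a t).op s₂ := by
  by_cases h' : ∀ k, a.toOrderHom k ≤ t.toOrderHom k
  · obtain rfl := hom_eq_of_le h h'
    rw [squareApp_of_le _ _ h', addHom_self, op_comp, Functor.map_comp_apply,
      Functor.map_comp_apply]
    exact congrArg _ hs
  · exact if_neg h'

lemma map_squareApp (hs : Y.δ 1 s₁ = Y.δ 1 s₂) (φ : d' ⟶ d) :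
    Y.map φ.op (squareApp s₁ s₂ a t) = squareApp s₁ s₂ (φ ≫ a) (φ ≫ t) := by
  by_cases h : ∀ k, a.toOrderHom k ≤ t.toOrderHom k
  · rw [squareApp_of_le _ _ h, squareApp_of_le (φ ≫ a) (φ ≫ t) (fun k ↦ h _), ← comp_addHom, op_comp,
      Functor.map_comp_apply]
  · have h' := le_of_not_le h
    rw [squareApp_of_ge _ _ hs h', squareApp_of_ge (φ ≫ a) (φ ≫ t) hs (fun k ↦ h' _), ← comp_addHom, op_comp,
      Functor.map_comp_apply]

lemma squareApp_zero_left (h : ∀ k, a.toOrderHom k = 0) :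
    squareApp s₁ s₂ a t = Y.map t.op (Y.δ 2 s₁) := by
  rw [squareApp_of_le _ _ (fun k ↦ by rw [h]; exact Fin.zero_le _), addHom_of_eq_zero _ _ h,
    op_comp, Functor.map_comp_apply]
  rfl

lemma squareApp_one_left (hs : Y.δ 1 s₁ = Y.δ 1 s₂) (h : ∀ k, a.toOrderHom k = 1) :
    squareApp s₁ s₂ a t = Y.map t.op (Y.δ 0 s₂) := by
  rw [squareApp_of_ge _ _ hs (fun k ↦ by rw [h]; exact Fin.le_last _), addHom_of_eq_one _ _ h,
    op_comp, Functor.map_comp_apply]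
  rfl

lemma squareApp_zero_right (hs : Y.δ 1 s₁ = Y.δ 1 s₂) (h : ∀ k, t.toOrderHom k = 0) :
    squareApp s₁ s₂ a t = Y.map a.op (Y.δ 2 s₂) := by
  rw [squareApp_of_ge _ _ hs (fun k ↦ by rw [h]; exact Fin.zero_le _), addHom_comm,
    addHom_of_eq_zero _ _ h, op_comp, Functor.map_comp_apply]
  rfl

lemma squareApp_one_right (h : ∀ k, t.toOrderHom k = 1) :
    squareApp s₁ s₂ a t = Y.map a.op (Y.δ 0 s₁) := by
  rw [squareApp_of_le _ _ (fun k ↦ by rw [h]; exact Fin.le_last _), addHom_comm,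
    addHom_of_eq_one _ _ h, op_comp, Functor.map_comp_apply]
  rfl

end

end SSet

/-! ### Paths and homotopies in exponentials -/

namespace SSet

open SSet.stdSimplex (objEquiv)

variable {Y : SSet.{u}}

/-- A `1`-simplex of `Y`, considered as a vertex of `expo Y Δ[1]`. -/
def pathVertex (e : Y _⦋1⦌) : (expo Y Δ[1]) _⦋0⦌ :=
  ({ app d _ := ↾fun t ↦ Y.map (objEquiv t).op e
     naturality φ a := by
      ext t
      exact Y.map_comp_apply (objEquiv t).op φ e } :
    Functor.HomObj Δ[1] Y _)

/-- The `1`-simplex of `expo Y Δ[1]` given by a commutative square. -/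
noncomputable def square (s₁ s₂ : Y _⦋2⦌) (hs : Y.δ 1 s₁ = Y.δ 1 s₂) : (expo Y Δ[1]) _⦋1⦌ :=
  ({ app d (a : op ⦋1⦌ ⟶ d) := ↾fun t ↦ squareApp s₁ s₂ a.unop (objEquiv t)
     naturality φ a := by
      ext t
      exact (map_squareApp _ _ hs φ.unop).symm } :
    Functor.HomObj Δ[1] Y _)

lemma expo_ext {K : SSet.{u}} {n : ℕ} {x y : (expo Y K) _⦋n⦌}
    (h : ∀ (d : SimplexCategoryᵒᵖ) (a : op ⦋n⦌ ⟶ d) (t : K.obj d),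
      (x : Functor.HomObj K Y _).app d a t = (y : Functor.HomObj K Y _).app d a t) : x = y :=
  Functor.functorHom_ext (fun d a ↦ by ext t; exact h d a t)

lemma comp_δ_one_apply {d : SimplexCategory} (a : d ⟶ ⦋0⦌) (k : Fin (d.len + 1)) :
    (a ≫ SimplexCategory.δ 1).toOrderHom k = 0 :=
  congrArg (Fin.succAbove (1 : Fin 2)) (Subsingleton.elim (α := Fin 1) (a.toOrderHom k) 0)

lemma comp_δ_zero_apply {d : SimplexCategory} (a : d ⟶ ⦋0⦌) (k : Fin (d.len + 1)) :
    (a ≫ SimplexCategory.δ 0).toOrderHom k = 1 :=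
  congrArg (Fin.succAbove (0 : Fin 2)) (Subsingleton.elim (α := Fin 1) (a.toOrderHom k) 0)

lemma δ_one_square (s₁ s₂ : Y _⦋2⦌) (hs : Y.δ 1 s₁ = Y.δ 1 s₂) :
    (expo Y Δ[1]).δ 1 (square s₁ s₂ hs) = pathVertex (Y.δ 2 s₁) :=
  expo_ext fun _ _ _ ↦ squareApp_zero_left _ _ (comp_δ_one_apply _)

lemma δ_zero_square (s₁ s₂ : Y _⦋2⦌) (hs : Y.δ 1 s₁ = Y.δ 1 s₂) :
    (expo Y Δ[1]).δ 0 (square s₁ s₂ hs) = pathVertex (Y.δ 0 s₂) :=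
  expo_ext fun _ _ _ ↦ squareApp_one_left _ _ hs (comp_δ_zero_apply _)

/-- The edge of `expo Y Δ[1]` given by a commutative square. -/
noncomputable def squareEdge {x₀₀ x₀₁ x₁₀ x₁₁ : Y _⦋0⦌} {e₀ : Edge x₀₀ x₀₁} {e₁ : Edge x₁₀ x₁₁}
    {f₀ : Edge x₀₀ x₁₀} {f₁ : Edge x₀₁ x₁₁} {g : Edge x₀₀ x₁₁}
    (c₁ : Edge.CompStruct e₀ f₁ g) (c₂ : Edge.CompStruct f₀ e₁ g) :
    Edge (pathVertex e₀.edge) (pathVertex e₁.edge) :=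
  Edge.mk (square c₁.simplex c₂.simplex (by simp))
    ((δ_one_square _ _ _).trans (by simp)) ((δ_zero_square _ _ _).trans (by simp))

/-- The subcomplex of `Δ[1]` consisting of the degenerate simplices on both vertices. -/
def ends : (Δ[1] : SSet.{u}).Subcomplex where
  obj _ := { t | ∀ k, (objEquiv t).toOrderHom k = (objEquiv t).toOrderHom 0 }
  map _ _ ht _ := (ht _).trans (ht _).symm

lemma ends_cases {d : SimplexCategoryᵒᵖ} (t : Δ[1].obj d) (ht : t ∈ ends.{u}.obj d) :
    (∀ k, (objEquiv t).toOrderHom k = 0) ∨ (∀ k, (objEquiv t).toOrderHom k = 1) := by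
  have h : ∀ b : Fin 2, b = 0 ∨ b = 1 := by decide
  exact (h ((objEquiv t).toOrderHom 0)).imp (fun h k ↦ (ht k).trans h) (fun h k ↦ (ht k).trans h)

section

variable {K : SSet.{u}} (z w : K ⟶ Y)

/-- The map `K ⟶ expo Y ends` given by two maps `K ⟶ Y`. -/
def endsMap : K ⟶ expo Y (ends : SSet.{u}) where
  app n := ↾fun x ↦
    ({ app d (a : n ⟶ d) := ↾fun t ↦ if (objEquiv t.1).toOrderHom 0 = 0 then z.app d (K.map a x)
          else w.app d (K.map a x)
       naturality {d d'} φ a := by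
        ext t
        have h : (objEquiv ((Subfunctor.toFunctor ends.{u}).map φ t).1).toOrderHom 0 =
          (objEquiv t.1).toOrderHom 0 := t.2 _
        change (if (objEquiv ((Subfunctor.toFunctor ends.{u}).map φ t).1).toOrderHom 0 = 0
          then z.app d' (K.map (a ≫ φ) x) else w.app d' (K.map (a ≫ φ) x)) =
            Y.map φ (if _ then _ else _)
        rw [h]
        split_ifs
        · rw [← NatTrans.naturality_apply, Functor.map_comp_apply]
        · rw [← NatTrans.naturality_apply, Functor.map_comp_apply] } :
      Functor.HomObj (ends : SSet.{u}) Y _)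
  naturality n m f := by
    ext x
    refine Functor.functorHom_ext (fun d a ↦ ?_)
    ext t
    change (if _ then z.app d (K.map a (K.map f x)) else w.app d (K.map a (K.map f x))) =
      if _ then z.app d (K.map (f ≫ a) x) else w.app d (K.map (f ≫ a) x)
    rw [Functor.map_comp_apply]

variable {z w}

lemma expo_app_map_apply {L : SSet.{u}} (H : K ⟶ expo Y L) {d d' e : SimplexCategoryᵒᵖ}
    (φ : d ⟶ d') (x : K.obj d) (a : d' ⟶ e) (t : L.obj e) :
    (H.app d' (K.map φ x) : Functor.HomObj L Y _).app e a t =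
      (H.app d x : Functor.HomObj L Y _).app e (φ ≫ a) t :=
  congrArg (fun y : (expo Y L).obj d' ↦ (y : Functor.HomObj L Y _).app e a t)
    (NatTrans.naturality_apply H φ x)

lemma expo_map_app_apply {L : SSet.{u}} {n d d' : SimplexCategoryᵒᵖ}
    (x : (expo Y L).obj n) (φ : d ⟶ d') (a : n ⟶ d) (t : L.obj d) :
    (x : Functor.HomObj L Y _).app d' (a ≫ φ) (L.map φ t) =
      Y.map φ ((x : Functor.HomObj L Y _).app d a t) :=
  ConcreteCategory.congr_hom (Functor.HomObj.naturality (F := L) (G := Y) x φ a) t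

/-- The `1`-simplex of `expo Y K` given by a map `K ⟶ expo Y Δ[1]`. -/
def homotopySimplex (H : K ⟶ expo Y Δ[1]) : (expo Y K) _⦋1⦌ :=
  ({ app d (a : op ⦋1⦌ ⟶ d) := ↾fun x ↦ (H.app d x : Functor.HomObj Δ[1] Y _).app d (𝟙 d)
        (objEquiv.symm a.unop)
     naturality {d d'} φ a := by
      ext x
      have h₁ := expo_app_map_apply H φ x (𝟙 d') (objEquiv.symm (φ.unop ≫ a.unop))
      have h₂ := expo_map_app_apply (H.app d x) φ (𝟙 d) (objEquiv.symm a.unop)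
      rw [Category.comp_id] at h₁
      rw [Category.id_comp] at h₂
      exact h₁.trans h₂ } :
    Functor.HomObj K Y _)

/-- The vertex of `expo Y K` given by a map `K ⟶ Y`. -/
def homVertex (z : K ⟶ Y) : (expo Y K) _⦋0⦌ :=
  (Functor.HomObj.ofNatTrans z : Functor.HomObj K Y _)

/-- Since ⦋0⦌ is terminal, the indexing operator of a vertex carries no information. -/
lemma homVertex_surjective (x : (expo Y K) _⦋0⦌) : ∃ z : K ⟶ Y, homVertex z = x := by
  let c (d : SimplexCategoryᵒᵖ) : op ⦋0⦌ ⟶ d := (SimplexCategory.isTerminalZero.from d.unop).op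
  have hc {d : SimplexCategoryᵒᵖ} (a : op ⦋0⦌ ⟶ d) : a = c d :=
    Quiver.Hom.unop_inj (SimplexCategory.isTerminalZero.hom_ext _ _)
  refine ⟨{ app d := (x : Functor.HomObj K Y _).app d (c d), naturality d d' φ := ?_ }, ?_⟩
  · ext t
    have := expo_map_app_apply x φ (c d) t
    rw [hc (c d ≫ φ)] at this
    exact this
  · refine expo_ext fun d a t ↦ ?_
    rw [hc a]
    rfl


lemma homotopySimplex_app_of_ends {H : K ⟶ expo Y Δ[1]} (h : H ≫ precomp Y ends.ι = endsMap z w)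
    {d : SimplexCategoryᵒᵖ} (x : K.obj d) (t : ends.{u}.obj d) :
    (H.app d x : Functor.HomObj Δ[1] Y _).app d (𝟙 d) t.1 =
      if (objEquiv t.1).toOrderHom 0 = 0 then z.app d x else w.app d x := by
  have h₁ := ConcreteCategory.congr_hom (NatTrans.congr_app h d) x
  have h₂ := congrArg (fun (g : (expo Y ends.toSSet).obj d) ↦
    (g : Functor.HomObj ends.toSSet Y _).app d (𝟙 d) t) h₁
  refine h₂.trans ?_
  change (if _ then z.app d (K.map (𝟙 d) x) else w.app d (K.map (𝟙 d) x)) = _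
  rw [Functor.map_id_apply]

lemma δ_one_homotopySimplex {H : K ⟶ expo Y Δ[1]} (h : H ≫ precomp Y ends.ι = endsMap z w) :
    (expo Y K).δ 1 (homotopySimplex H) = homVertex z := by
  refine expo_ext fun d a x ↦ ?_
  have ha := comp_δ_one_apply a.unop
  refine (homotopySimplex_app_of_ends h x ⟨objEquiv.symm (a.unop ≫ SimplexCategory.δ 1),
    fun k ↦ (ha k).trans (ha 0).symm⟩).trans (if_pos (ha 0))

lemma δ_zero_homotopySimplex {H : K ⟶ expo Y Δ[1]} (h : H ≫ precomp Y ends.ι = endsMap z w) :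
    (expo Y K).δ 0 (homotopySimplex H) = homVertex w := by
  refine expo_ext fun d a x ↦ ?_
  have ha := comp_δ_zero_apply a.unop
  refine (homotopySimplex_app_of_ends h x ⟨objEquiv.symm (a.unop ≫ SimplexCategory.δ 0),
    fun k ↦ (ha k).trans (ha 0).symm⟩).trans (if_neg ?_)
  refine fun h ↦ Fin.zero_ne_one (h.symm.trans (ha 0))

/-- The edge of `expo Y K` given by a homotopy between maps `K ⟶ Y`. -/
def homotopyEdge (H : K ⟶ expo Y Δ[1]) (h : H ≫ precomp Y ends.ι = endsMap z w) :
    Edge (homVertex z) (homVertex w) :=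
  Edge.mk (homotopySimplex H) (δ_one_homotopySimplex h) (δ_zero_homotopySimplex h)

end

end SSet

namespace SSet

open SSet.stdSimplex (objEquiv)

variable {Y : SSet.{u}} (e : Y _⦋1⦌) {d : SimplexCategoryᵒᵖ} (a : op ⦋0⦌ ⟶ d) (t : Δ[1].obj d)

lemma pathVertex_app_of_eq_zero (ht : ∀ k, (objEquiv t).toOrderHom k = 0) :
    (pathVertex e : Functor.HomObj Δ[1] Y _).app d a t = Y.map a (Y.δ 1 e) := by
  have h : objEquiv t = a.unop ≫ SimplexCategory.δ 1 := by
    ext k : 3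
    exact (ht k).trans (comp_δ_one_apply _ _).symm
  exact (congrArg (fun f ↦ Y.map (Quiver.Hom.op f) e) h).trans (Y.map_comp_apply _ _ _)

lemma pathVertex_app_of_eq_one (ht : ∀ k, (objEquiv t).toOrderHom k = 1) :
    (pathVertex e : Functor.HomObj Δ[1] Y _).app d a t = Y.map a (Y.δ 0 e) := by
  have h : objEquiv t = a.unop ≫ SimplexCategory.δ 0 := by
    ext k : 3
    exact (ht k).trans (comp_δ_zero_apply _ _).symm
  exact (congrArg (fun f ↦ Y.map (Quiver.Hom.op f) e) h).trans (Y.map_comp_apply _ _ _)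

end SSet

/-! ### Lifting diagrams and natural transformations from the homotopy category -/

namespace CategoryTheory.LengthStructure

lemma eqToHom_conj_comp_eqToHom {C : Type*} [Category* C] {a b c d a' d' : C} (f : b ⟶ c)
    (p₁ : a = a') (p₂ : a' = b) (p₃ : c = d) (p₄ : d = d') (p₅ : d' = c) (p₆ : a = b) :
    (eqToHom p₁ ≫ (eqToHom p₂ ≫ f ≫ eqToHom p₃) ≫ eqToHom p₄) ≫ eqToHom p₅ = eqToHom p₆ ≫ f := by
  subst p₁ p₂ p₃ p₄
  simp

/-- Naturality squares paste, so induction on length reduces the claim to generators. -/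
lemma naturality_of_len_eq_one {C : Type*} [Category* C] {D : Type*} [Category* D]
    (L : LengthStructure C) {F G : C ⥤ D} (α : ∀ x, F.obj x ⟶ G.obj x)
    (h : ∀ {x y : C} (f : x ⟶ y), L.len f = 1 → F.map f ≫ α y = α x ≫ G.map f)
    {x y : C} (f : x ⟶ y) : F.map f ≫ α y = α x ≫ G.map f := by
  obtain ⟨n, hn⟩ : ∃ n, L.len f = n := ⟨_, rfl⟩
  induction n generalizing x y with
  | zero =>
    obtain ⟨rfl, rfl⟩ := L.eq_eqToHom f hn
    simp
  | succ n ih =>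
    obtain _ | n := n
    · exact h f hn
    · obtain ⟨z, g, g', hg, rfl⟩ := L.exists_fac f (by lia)
      rw [L.len_comp] at hn
      rw [F.map_comp, G.map_comp, Category.assoc, ih g' (by lia), reassoc_of% h g hg]

end CategoryTheory.LengthStructure

namespace SSet

variable {C : Type u} [SmallCategory C] {Y : SSet.{u}}

lemma Edge.CompStruct.hoHom_comp_hoHom {x y z : Y _⦋0⦌} {e : Edge x y} {e' : Edge y z}
    {e'' : Edge x z} (c : Edge.CompStruct e e' e'') : e.hoHom ≫ e'.hoHom = e''.hoHom :=
  HomotopyCategory.homMk_comp_homMk c.toTruncated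

/-- The functor to the homotopy category given by a map from the nerve. -/
def nerveHo (z : nerve C ⟶ Y) : C ⥤ ho Y where
  obj x := hoMk (z.app _ (nerveEquiv.symm x))
  map f := ((nerve.edgeMk f).map z).hoHom
  map_id x := by
    rw [nerve.edgeMk_id]
    exact (congrArg Edge.hoHom (Edge.map_id _ z)).trans (HomotopyCategory.homMk_id _)
  map_comp f g := by
    obtain ⟨c⟩ := (nerve.nonempty_compStruct_iff f g (f ≫ g)).2 rfl
    exact ((c.map z).hoHom_comp_hoHom).symm

end SSet

namespace CategoryTheory.LengthStructure

open SSet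

variable {C : Type u} [SmallCategory C] {Y : SSet.{u}} [Quasicategory Y]

lemma exists_nerveHo_iso (L : LengthStructure C) (X : C ⥤ ho Y) : ∃ z : nerve C ⟶ Y, Nonempty (nerveHo z ≅ X) := by
  have h₀ (x : C) : ∃ y : Y _⦋0⦌, hoMk y = X.obj x := by
    obtain ⟨y, hy⟩ := HomotopyCategory.mk_surjective (V := (truncation 2).obj Y) (X.obj x)
    exact ⟨y, hy⟩
  choose v hv using h₀
  have h₁ (x y : C) (f : x ⟶ y) : ∃ e : Edge (v x) (v y),
      e.hoHom = eqToHom (hv x) ≫ X.map f ≫ eqToHom (hv y).symm := by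
    obtain ⟨e, he⟩ := Truncated.HomotopyCategory.exists_homMk_eq
      (eqToHom (hv x) ≫ X.map f ≫ eqToHom (hv y).symm)
    exact ⟨Edge.ofTruncated e, he⟩
  choose e he using h₁
  obtain ⟨z, hz⟩ := L.innerAnodyneExtensions_spine_ι.exists_extension
    (L.spineDesc v (fun {x y} f _ ↦ e x y f))
  have hz₀ (x : C) : z.app (op ⦋0⦌) (nerveEquiv.symm x) = v x :=
    (ConcreteCategory.congr_hom (NatTrans.congr_app hz _) ⟨nerveEquiv.symm x,
      (L.coord_zero (n := 0) _).trans_le (Nat.zero_le _)⟩).trans (L.spineDesc_app_zero _ _ _)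
  have hz₁ {x y : C} (f : x ⟶ y) (hf : L.len f = 1) :
      z.app _ (nerve.edgeMk f).edge = (e x y f).edge :=
    (ConcreteCategory.congr_hom (NatTrans.congr_app hz _) ⟨(nerve.edgeMk f).edge, hf.le⟩).trans
      (L.spineDesc_app_one _ _ _ hf)
  have hv' (x : C) : (nerveHo z).obj x = X.obj x := (congrArg hoMk (hz₀ x)).trans (hv x)
  -- The extension z is prescribed only on the spine, so naturality is checked only on generators;
  -- the components are transports along equalities of objects.
  refine ⟨z, ⟨NatIso.ofComponents (fun x ↦ eqToIso (hv' x))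
    (L.naturality_of_len_eq_one (fun x ↦ eqToHom (hv' x)) fun {x y} f hf ↦ ?_)⟩⟩
  have h := homMk_eq_of_edge_eq ((nerve.edgeMk f).map z).toTruncated (e x y f).toTruncated (hz₁ f hf)
    (congrArg hoMk (hz₀ x)) (congrArg hoMk (hz₀ y)).symm
  change (nerveHo z).map f = _ ≫ (e x y f).hoHom ≫ _ at h
  rw [h, he]
  exact eqToHom_conj_comp_eqToHom _ _ _ _ _ _ _

lemma exists_edge_of_natTrans (L : LengthStructure C) {z w : nerve C ⟶ Y} (α : nerveHo z ⟶ nerveHo w) :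
    ∃ e : Edge (homVertex z) (homVertex w), ∀ x : C,
      ∃ e' : Edge (z.app _ (nerveEquiv.symm x)) (w.app _ (nerveEquiv.symm x)),
        e'.hoHom = α.app x ∧
        (Prederivator.evalVertex Y (nerveEquiv.symm x)).app _ e.edge = e'.edge := by
  have h₀ (x : C) : ∃ e' : Edge (z.app _ (nerveEquiv.symm x)) (w.app _ (nerveEquiv.symm x)),
      e'.hoHom = α.app x := by
    obtain ⟨e, he⟩ := Truncated.HomotopyCategory.exists_homMk_eq (α.app x)
    exact ⟨Edge.ofTruncated e, he⟩
  choose e he using h₀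
  have h₁ (x y : C) (f : x ⟶ y) : ∃ (g : Edge _ _)
      (c₁ : Edge.CompStruct (e x) ((nerve.edgeMk f).map w) g)
      (c₂ : Edge.CompStruct ((nerve.edgeMk f).map z) (e y) g), True := by
    -- The first triangle chooses the diagonal g by horn filling; naturality of α then gives a
    -- second triangle with the same diagonal.
    obtain ⟨g, c₁⟩ := Edge.nonempty_comp (e x) ((nerve.edgeMk f).map w)
    obtain ⟨c₂⟩ := Truncated.HomotopyCategory.nonempty_compStruct_of_fac
      (f := ((nerve.edgeMk f).map z).toTruncated) (g := (e y).toTruncated) (h := g.toTruncated) (by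
        have h := α.naturality f
        rw [← he, ← he] at h
        exact h.trans c₁.hoHom_comp_hoHom)
    exact ⟨g, c₁, Edge.CompStruct.ofTruncated c₂, trivial⟩
  choose g c₁ c₂ _ using h₁
  let φ := L.spineDesc (fun x ↦ pathVertex (e x).edge) (fun {x y} f _ ↦ squareEdge (c₁ x y f) (c₂ x y f))
  -- Over the ends 0 and 1 of the path, the square at f restricts to the edges given by f under z
  -- and w.
  have hφ : φ ≫ precomp Y ends.ι = L.spine.ι ≫ endsMap z w := by
    refine L.spine_hom_ext (fun x ↦ ?_) (fun x hx ↦ ?_)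
    · refine (congrArg ((precomp Y ends.ι).app _) (L.spineDesc_app_zero _ _ x)).trans ?_
      refine expo_ext fun d a t ↦ ?_
      obtain ⟨x, hx⟩ := x
      obtain ⟨x, rfl⟩ := nerveEquiv.symm.surjective x
      obtain ht | ht := ends_cases _ t.2
      · refine (pathVertex_app_of_eq_zero _ a _ ht).trans (Eq.trans ?_ (if_pos (ht 0)).symm)
        exact (congrArg (Y.map a) (e x).src_eq).trans (NatTrans.naturality_apply z a _).symm
      · refine (pathVertex_app_of_eq_one _ a _ ht).trans (Eq.trans ?_ (if_neg ?_).symm)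
        · exact (congrArg (Y.map a) (e x).tgt_eq).trans (NatTrans.naturality_apply w a _).symm
        · exact fun h ↦ Fin.zero_ne_one (h.symm.trans (ht 0))
    · refine (congrArg ((precomp Y ends.ι).app _) (L.spineDesc_app_one _ _ x hx)).trans ?_
      refine expo_ext fun d a t ↦ ?_
      obtain ⟨x, hx'⟩ := x
      obtain ⟨x, y, f, rfl⟩ := ComposableArrows.mk₁_surjective x
      obtain ht | ht := ends_cases _ t.2
      · refine (squareApp_zero_right a.unop _
          ((c₁ x y f).d₁.trans (c₂ x y f).d₁.symm) ht).trans (Eq.trans ?_ (if_pos (ht 0)).symm)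
        exact (congrArg (Y.map a) (c₂ x y f).d₂).trans (NatTrans.naturality_apply z a _).symm
      · refine (squareApp_one_right a.unop _ ht).trans (Eq.trans ?_ (if_neg ?_).symm)
        · exact (congrArg (Y.map a) (c₁ x y f).d₀).trans (NatTrans.naturality_apply w a _).symm
        · exact fun h ↦ Fin.zero_ne_one (h.symm.trans (ht 0))
  obtain ⟨H, hH, hH'⟩ := L.innerAnodyneExtensions_spine_ι.exists_lift _ _ _ hφ
  refine ⟨homotopyEdge H hH', fun x ↦ ⟨e x, he x, ?_⟩⟩
  have h₂ : H.app (op ⦋0⦌) (nerveEquiv.symm x) = pathVertex (e x).edge :=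
    (ConcreteCategory.congr_hom (NatTrans.congr_app hH _) ⟨nerveEquiv.symm x,
      (L.coord_zero (n := 0) _).trans_le (Nat.zero_le _)⟩).trans (L.spineDesc_app_zero _ _ _)
  refine (expo_app_map_apply H _ _ _ _).trans ?_
  rw [h₂]
  exact Y.map_id_apply _ _

end CategoryTheory.LengthStructure

/-! ### The underlying diagram functor for free categories -/

namespace Prederivator

open SSet

variable {F : Cat.{u, u}} {Y : SSet.{max u v}}

/-- The universe lift and the isomorphism with a path category are fully faithful and bijective on
objects, so path length pulls back along both. -/
lemma IsFreeCategory.nonempty_lengthStructure (hF : IsFreeCategory F) :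
    Nonempty (LengthStructure (AsSmall.{v} F)) := by
  obtain ⟨Q, ⟨e⟩⟩ := hF
  let E : F ≌ Cat.free.obj Q := Cat.equivOfIso e
  have hE : Function.Bijective E.functor.obj := by
    refine Function.bijective_iff_has_inverse.2 ⟨E.inverse.obj, fun x ↦ ?_, fun x ↦ ?_⟩
    · exact congrArg (fun G ↦ G.toFunctor.obj x) e.hom_inv_id
    · exact congrArg (fun G ↦ G.toFunctor.obj x) e.inv_hom_id
  let L : LengthStructure (Cat.free.obj Q) := LengthStructure.paths Q
  have hD : Function.Bijective (AsSmall.down.{_, _, v} (C := F)).obj := ULift.down_bijective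
  have : (AsSmall.down.{_, _, v} (C := F)).IsEquivalence :=
    (AsSmall.equiv (C := F)).symm.isEquivalence_functor
  exact ⟨(L.pullback E.functor hE).pullback AsSmall.down hD⟩

lemma underlyingDiagram_obj_map (z : smallNerve.{u, v} F ⟶ Y) {i j : F} (f : i ⟶ j) :
    ((underlyingDiagram Y F).obj (hoMk (homVertex z))).map f =
      (nerveHo z).map (AsSmall.up.map f) := by
  let τ := (Functor.const (Discrete PUnit.{u + 1})).map f
  refine congrArg Edge.hoHom (Edge.ext
    (e := (natEdge Y (liftNat.{u, v} (I := point) (J := F) τ) (homVertex z)).map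
      (evalVertex Y pointVertex.{u, v}))
    (e' := (nerve.edgeMk (AsSmall.up.map f)).map z) ?_)
  refine congrArg (z.app (op ⦋1⦌)) (ComposableArrows.ext₁ rfl rfl ?_)
  have h : AsSmall.up.{_, _, v}.map f ≫ 𝟙 _ = 𝟙 _ ≫ AsSmall.up.{_, _, v}.map f ≫ 𝟙 _ := by simp
  exact h

lemma underlyingDiagram_map_app {z w : smallNerve.{u, v} F ⟶ Y}
    (e : Edge (homVertex z) (homVertex w)) (i : F) 
    (e' : Edge (z.app (op ⦋0⦌) (nerveEquiv.symm (AsSmall.up.obj i)))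
      (w.app (op ⦋0⦌) (nerveEquiv.symm (AsSmall.up.obj i))))
    (h : (evalVertex Y (nerveEquiv.symm (AsSmall.up.obj i))).app (op ⦋1⦌) e.edge = e'.edge) :
    ((underlyingDiagram Y F).map e.hoHom).app i = e'.hoHom := 
  congrArg Edge.hoHom (Edge.ext h)

lemma essSurj_underlyingDiagram [Quasicategory Y] (hF : IsFreeCategory F) :
    (underlyingDiagram Y F).EssSurj where
  mem_essImage X := by
    obtain ⟨L⟩ := hF.nonempty_lengthStructure
    obtain ⟨z, ⟨e⟩⟩ := L.exists_nerveHo_iso (AsSmall.down.{_, _, v} ⋙ X)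
    exact ⟨hoMk (homVertex z), ⟨NatIso.ofComponents (fun i ↦ e.app (AsSmall.up.obj i))
      (fun f ↦ (congrArg (· ≫ _) (underlyingDiagram_obj_map z f)).trans
        (e.hom.naturality (AsSmall.up.map f)))⟩⟩

lemma full_underlyingDiagram [Quasicategory Y] (hF : IsFreeCategory F) :
    (underlyingDiagram Y F).Full where
  map_surjective {X X'} φ := by
    obtain ⟨L⟩ := hF.nonempty_lengthStructure
    obtain ⟨x, rfl⟩ := HomotopyCategory.mk_surjective X
    obtain ⟨z, rfl⟩ := homVertex_surjective x
    obtain ⟨x', rfl⟩ := HomotopyCategory.mk_surjective X'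
    obtain ⟨w, rfl⟩ := homVertex_surjective x'
    let α : nerveHo z ⟶ nerveHo w :=
      { app x := φ.app (AsSmall.down.obj x)
        naturality x y f := by
          have h := φ.naturality (AsSmall.down.map f)
          erw [underlyingDiagram_obj_map, underlyingDiagram_obj_map] at h
          exact h }
    obtain ⟨e, he⟩ := L.exists_edge_of_natTrans α
    refine ⟨e.hoHom, NatTrans.ext (funext fun i ↦ ?_)⟩
    obtain ⟨e', he', h⟩ := he (AsSmall.up.obj i)
    exact (underlyingDiagram_map_app e i e' h).trans he'

end Prederivator

/-! ### The exponential law and strongness -/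

namespace SSet

variable (C K L : SSet.{u})

variable {C K L} in
-- An iterated simplex is determined by its inner values at identity operators; this yields the
-- inverse of `curryExpo`.
lemma expo_expo_app_apply {n d d' : SimplexCategoryᵒᵖ} (y : (expo (expo C K) L).obj n)
    (a : n ⟶ d) (b : d ⟶ d') (σ : L.obj d) (ρ : K.obj d') :
    ((y : Functor.HomObj L (expo C K) _).app d' (a ≫ b) (L.map b σ) :
      Functor.HomObj K C _).app d' (𝟙 d') ρ =
      ((y : Functor.HomObj L (expo C K) _).app d a σ : Functor.HomObj K C _).app d' b ρ := by
  have h := congrArg (fun z : (expo C K).obj d' ↦ (z : Functor.HomObj K C _).app d' (𝟙 d') ρ)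
    (expo_map_app_apply y b a σ)
  refine h.trans ?_
  change ((y : Functor.HomObj L (expo C K) _).app d a σ : Functor.HomObj K C _).app d' (b ≫ 𝟙 d') ρ
    = _
  rw [Category.comp_id]

/-- The map `C ^ (K × L) ⟶ (C ^ K) ^ L`. -/
def curryExpo : expo C (K ⊗ L) ⟶ expo (expo C K) L where
  app n := ↾fun (x : Functor.HomObj (K ⊗ L) C _) ↦
    ({ app d (a : n ⟶ d) := ↾fun σ ↦
        ({ app d' (b : d ⟶ d') := ↾fun ρ ↦ x.app d' (a ≫ b) (ρ, L.map b σ)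
           naturality {d₁ d₂} φ (b : d ⟶ d₁) := by
            ext ρ
            have h := expo_map_app_apply (L := K ⊗ L) x φ (a ≫ b) (ρ, L.map b σ)
            have h' : L.map (b ≫ φ) σ = L.map φ (L.map b σ) := Functor.map_comp_apply ..
            change x.app d₂ (a ≫ b ≫ φ) (K.map φ ρ, L.map (b ≫ φ) σ) = _
            rw [h', ← Category.assoc]
            exact h } : Functor.HomObj K C _)
       naturality {d₁ d₂} φ (a : n ⟶ d₁) := by
        ext σ
        refine Functor.functorHom_ext (fun d (b : d₂ ⟶ d) ↦ ?_)
        ext ρ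
        change x.app d ((a ≫ φ) ≫ b) (ρ, L.map b (L.map φ σ)) =
          x.app d (a ≫ φ ≫ b) (ρ, L.map (φ ≫ b) σ)
        rw [Functor.map_comp_apply, Category.assoc] } :
      Functor.HomObj L (expo C K) _)
  naturality n m f := by
    ext x
    refine Functor.functorHom_ext (fun d (a : m ⟶ d) ↦ ?_)
    ext σ
    refine Functor.functorHom_ext (fun d' (b : d ⟶ d') ↦ ?_)
    ext ρ
    let x' : Functor.HomObj (K ⊗ L) C _ := x
    change x'.app d' (f ≫ a ≫ b) (ρ, L.map b σ) = x'.app d' ((f ≫ a) ≫ b) (ρ, L.map b σ)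
    rw [Category.assoc]

instance : IsIso (curryExpo C K L) := by
  have (n : SimplexCategoryᵒᵖ) : IsIso ((curryExpo C K L).app n) := by
    rw [isIso_iff_bijective]
    refine ⟨fun x y h ↦ ?_, fun y ↦ ?_⟩
    · refine Functor.functorHom_ext (fun d a ↦ ?_)
      ext ⟨ρ, σ⟩
      let x' : Functor.HomObj (K ⊗ L) C _ := x
      let y' : Functor.HomObj (K ⊗ L) C _ := y
      have h₁ : x'.app d (a ≫ 𝟙 d) (ρ, L.map (𝟙 d) σ) = y'.app d (a ≫ 𝟙 d) (ρ, L.map (𝟙 d) σ) :=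
        congrArg (fun z : (expo (expo C K) L).obj n ↦
          ((z : Functor.HomObj L (expo C K) _).app d a σ : Functor.HomObj K C _).app d (𝟙 d) ρ) h
      rw [Category.comp_id, Functor.map_id_apply] at h₁
      exact h₁
    · let y' : Functor.HomObj L (expo C K) _ := y
      refine ⟨({ app d a := ↾fun (π : K.obj d × L.obj d) ↦
          (y'.app d a π.2 : Functor.HomObj K C _).app d (𝟙 d) π.1
                 naturality {d₁ d₂} φ a := ?_ } : Functor.HomObj (K ⊗ L) C _), ?_⟩
      · ext ⟨ρ, σ⟩
        have h := expo_map_app_apply (Y := C) (L := K) (y'.app d₁ a σ) φ (𝟙 d₁) ρ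
        rw [Category.id_comp] at h
        exact (expo_expo_app_apply y a φ σ _).trans h
      · refine Functor.functorHom_ext (fun d a ↦ ?_)
        ext σ
        refine Functor.functorHom_ext (fun d' b ↦ ?_)
        ext ρ
        exact expo_expo_app_apply y a b σ ρ
  exact NatIso.isIso_of_isIso_app _

instance {K L : SSet.{u}} (f : K ⟶ L) [IsIso f] : IsIso (precomp C f) := 
  ⟨precomp C (inv f), by rw [← precomp_comp, IsIso.inv_hom_id, precomp_id],
    by rw [← precomp_comp, IsIso.hom_inv_id, precomp_id]⟩

end SSet

namespace SSet

lemma Edge.hoHom_comp_eqToHom {X : SSet.{u}} {x y x' y' : X _⦋0⦌} (e : Edge x y) (e' : Edge x' y')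
    (h : e.edge = e'.edge) (hx : x = x') (hy : y = y') :
    e.hoHom ≫ eqToHom (congrArg hoMk hy) = eqToHom (congrArg hoMk hx) ≫ e'.hoHom := by
  subst hx hy
  obtain rfl := Edge.ext h
  simp

end SSet

namespace Prederivator

open SSet

variable (C : SSet.{max u v}) (A F : Cat.{u, u})

/-- The functor `AsSmall A × AsSmall F ⥤ AsSmall (A × F)`. -/
abbrev asSmallProd : AsSmall.{v} A × AsSmall.{v} F ⥤ AsSmall.{v} (A × F) :=
  (AsSmall.down.prod AsSmall.down) ⋙ AsSmall.up

/-- The comparison map from the product of the nerves to the nerve of the product. -/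
def nerveProd : smallNerve.{u, v} A ⊗ smallNerve.{u, v} F ⟶ smallNerve (Cat.of (A × F)) where
  app n := ↾fun (z : ComposableArrows (AsSmall.{v} A) n.unop.len ×
    ComposableArrows (AsSmall.{v} F) n.unop.len) ↦
      (z.1.prod' z.2 ⋙ asSmallProd A F : ComposableArrows _ n.unop.len)
  naturality _ _ _ := rfl

instance : IsIso (nerveProd.{u, v} A F) := by
  have (n : SimplexCategoryᵒᵖ) : IsIso ((nerveProd.{u, v} A F).app n) := by
    rw [isIso_iff_bijective]
    refine Function.bijective_iff_has_inverse.2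
      ⟨fun (z : ComposableArrows (AsSmall.{v} (A × F)) n.unop.len) ↦
        ((z ⋙ AsSmall.down ⋙ CategoryTheory.Prod.fst A F ⋙ AsSmall.up,
          z ⋙ AsSmall.down ⋙ CategoryTheory.Prod.snd A F ⋙ AsSmall.up) :
          ComposableArrows (AsSmall.{v} A) n.unop.len ×
            ComposableArrows (AsSmall.{v} F) n.unop.len), fun _ ↦ rfl, fun _ ↦ rfl⟩
  exact NatIso.isIso_of_isIso_app _

/-- The isomorphism `C ^ N(A × F) ⟶ (C ^ (N A)) ^ (N F)`. -/
def expoProd : expo C (smallNerve (Cat.of (A × F))) ⟶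
    expo (expo C (smallNerve.{u, v} A)) (smallNerve F) :=
  precomp C (nerveProd A F) ≫ curryExpo C _ _

instance : IsIso (expoProd.{u, v} C A F) :=
  inferInstanceAs (IsIso (precomp C (nerveProd.{u, v} A F) ≫ curryExpo C _ _))

lemma prod'_uncurry_flip_curry {I J M N P : Type*} [Category* I] [Category* J] [Category* M]
    [Category* N] [Category* P] (K : I × J ⥤ M) (ρ : N ⥤ I) (p : N ⥤ P) (S : P ⥤ J) :
    p.prod' ρ ⋙ Functor.uncurry.obj (S ⋙ (Functor.curry.obj K).flip) =
      ρ.prod' (p ⋙ S) ⋙ K := by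
  refine CategoryTheory.Functor.ext (fun _ ↦ rfl) (fun _ _ f ↦ ?_)
  simp [← Functor.map_comp]

variable {A F}

lemma mk₁_liftNat_const {i j : F} (f : i ⟶ j) :
    (SimplexCategory.toCat.map (𝟙 ⦋1⦌)).toFunctor.prod' ((SimplexCategory.toCat.map
      (SimplexCategory.const ⦋1⦌ ⦋0⦌ 0)).toFunctor ⋙ pointVertex.{u, v}) ⋙
      Functor.uncurry.obj (ComposableArrows.mk₁ (liftNat.{u, v} (I := point) (J := F)
        ((Functor.const (Discrete PUnit.{u + 1})).map f))) =
    (ComposableArrows.mk₁ (AsSmall.up.{_, _, v}.map f) : ComposableArrows _ 1) := by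
  refine ComposableArrows.ext₁ rfl rfl ?_
  have h : AsSmall.up.{_, _, v}.map f ≫ 𝟙 _ = 𝟙 _ ≫ AsSmall.up.{_, _, v}.map f ≫ 𝟙 _ := by simp
  exact h

/-- Both edges restrict x along the prism N A × Δ[1] → N(A × F) which is the identity on A and
traces f in F. One uses the transformation between the inclusions of A, the other the edge f after
currying. -/
lemma partialDiag_edge_eq (x : (expo C (smallNerve.{u, v} (Cat.of (A × F)))) _⦋0⦌) {i j : F}
    (f : i ⟶ j) :
    (natEdge C (liftNat.{u, v} (I := A) (J := Cat.of (A × F))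
      ((Functor.curry.obj (𝟭 (A × F))).flip.map f)) x).edge =
    (evalVertex (expo C (smallNerve.{u, v} A)) pointVertex.{u, v}).app _
      (natEdge (expo C (smallNerve.{u, v} A)) (liftNat.{u, v} (I := point) (J := F)
        ((Functor.const (Discrete PUnit.{u + 1})).map f)) ((expoProd C A F).app _ x)).edge := by
  refine expo_ext fun d a ρ ↦ ?_
  let x' : Functor.HomObj _ C _ := x
  let p := (SimplexCategory.toCat.map a.unop).toFunctor
  let q : ComposableArrows (AsSmall.{v} F) 1 :=
    (SimplexCategory.toCat.map (𝟙 ⦋1⦌)).toFunctor.prod' ((SimplexCategory.toCat.map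
      (SimplexCategory.const ⦋1⦌ ⦋0⦌ 0)).toFunctor ⋙ pointVertex.{u, v}) ⋙
      Functor.uncurry.obj (ComposableArrows.mk₁ (liftNat.{u, v} (I := point) (J := F)
        ((Functor.const (Discrete PUnit.{u + 1})).map f)))
  have hq : q = ComposableArrows.mk₁ (AsSmall.up.map f) := mk₁_liftNat_const f
  have h : p.prod' ρ ⋙ Functor.uncurry.obj (ComposableArrows.mk₁
      (liftNat.{u, v} (I := A) (J := Cat.of (A × F))
        ((Functor.curry.obj (𝟭 (A × F))).flip.map f))) =
      ρ.prod' (p ⋙ q) ⋙ asSmallProd A F := by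
    rw [hq]
    refine Eq.trans ?_ (prod'_uncurry_flip_curry (asSmallProd A F) ρ p
      (ComposableArrows.mk₁ (AsSmall.up.map f)))
    exact congrArg (fun S ↦ p.prod' ρ ⋙ Functor.uncurry.obj S) (ComposableArrows.mk₁_hom
      (ComposableArrows.mk₁ (AsSmall.up.map f) ⋙ (Functor.curry.obj (asSmallProd A F)).flip))
  refine (?_ : x'.app d ((SimplexCategory.σ 0).op ≫ a) _ =
    x'.app d (((SimplexCategory.σ 0).op ≫ 𝟙 _) ≫ a) (ρ.prod' (p ⋙ q) ⋙ asSmallProd A F))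
  rw [Category.comp_id]
  exact congrArg (x'.app d ((SimplexCategory.σ 0).op ≫ a)) h

/-- Dimension zero compares the objects of the two diagrams, and dimension one gives naturality in
x. -/
lemma partialDiag_simplex_eq {n : ℕ}
    (x : (expo C (smallNerve.{u, v} (Cat.of (A × F)))) _⦋n⦌) (i : F) :
    (precomp C (nerveMap (lift.{u, v} (I := A) (J := Cat.of (A × F))
      ((Functor.curry.obj (𝟭 (A × F))).flip.obj i)))).app (op ⦋n⦌) x =
    (evalVertex (expo C (smallNerve.{u, v} A)) pointVertex.{u, v}).app (op ⦋n⦌)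
      ((precomp (expo C (smallNerve.{u, v} A)) (nerveMap (lift.{u, v} (I := point) (J := F)
        ((Functor.const (Discrete PUnit.{u + 1})).obj i)))).app (op ⦋n⦌) ((expoProd C A F).app (op ⦋n⦌) x)) := by
  refine expo_ext fun d a ρ ↦ ?_
  let x' : Functor.HomObj _ C _ := x
  refine (?_ : x'.app d a (ρ ⋙ (lift.{u, v} (I := A) (J := Cat.of (A × F))
      ((Functor.curry.obj (𝟭 (A × F))).flip.obj i))) = x'.app d (𝟙 _ ≫ a) _)
  rw [Category.id_comp]
  rfl

/-- The partial underlying diagram functor for `C` is the underlying diagram functor for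
`C ^ (N A)`. -/
def partialDiagIso : (hoInfinity.{u, v} C).partialDiag A F ≅
    (hoFunctor.map (expoProd C A F)).toFunctor ⋙
      underlyingDiagram.{u, v} (expo C (smallNerve.{u, v} A)) F :=
  HomotopyCategory.mkNatIso
    (fun x ↦ NatIso.ofComponents
      (fun i ↦ eqToIso (congrArg hoMk (partialDiag_simplex_eq C x i))) (by
        intro i j f
        have h := Edge.hoHom_comp_eqToHom (natEdge C (liftNat.{u, v} (I := A) (J := Cat.of (A × F))
            ((Functor.curry.obj (𝟭 (A × F))).flip.map f)) x)
          ((natEdge (expo C (smallNerve.{u, v} A)) (liftNat.{u, v} (I := point) (J := F)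
            ((Functor.const (Discrete PUnit.{u + 1})).map f)) ((expoProd C A F).app _ x)).map
            (evalVertex (expo C (smallNerve.{u, v} A)) pointVertex.{u, v}))
          (partialDiag_edge_eq C x f)
          (partialDiag_simplex_eq C x i)
          (partialDiag_simplex_eq C x j)
        exact h))
    (by
      intro (x : (expo C _) _⦋0⦌) (y : (expo C _) _⦋0⦌) (e : Edge x y)
      refine NatTrans.ext (funext fun i ↦ ?_)
      have h := Edge.hoHom_comp_eqToHom (e.map (precomp C (nerveMap (lift.{u, v} (I := A)
            (J := Cat.of (A × F)) ((Functor.curry.obj (𝟭 (A × F))).flip.obj i)))))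
          (((e.map (expoProd C A F)).map (precomp (expo C (smallNerve.{u, v} A)) (nerveMap
            (lift.{u, v} (I := point) (J := F)
              ((Functor.const (Discrete PUnit.{u + 1})).obj i))))).map
            (evalVertex (expo C (smallNerve.{u, v} A)) pointVertex.{u, v}))
          (partialDiag_simplex_eq C e.edge i)
          (partialDiag_simplex_eq C x i)
          (partialDiag_simplex_eq C y i)
      exact h)

lemma isStrong_hoInfinity [Quasicategory C] : (hoInfinity.{u, v} C).IsStrong := by
  intro A F hF
  have h₁ := full_underlyingDiagram (Y := expo C (smallNerve.{u, v} A)) hF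
  have h₂ := essSurj_underlyingDiagram (Y := expo C (smallNerve.{u, v} A)) hF
  have h₃ : (hoFunctor.map (expoProd.{u, v} C A F)).toFunctor.IsEquivalence :=
    (Cat.equivOfIso (asIso (hoFunctor.map (expoProd.{u, v} C A F)))).isEquivalence_functor
  have h₄ := Functor.Full.comp (hoFunctor.map (expoProd.{u, v} C A F)).toFunctor
    (underlyingDiagram.{u, v} (expo C (smallNerve.{u, v} A)) F)
  have h₅ := Functor.essSurj_comp (hoFunctor.map (expoProd.{u, v} C A F)).toFunctor
    (underlyingDiagram.{u, v} (expo C (smallNerve.{u, v} A)) F)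
  exact ⟨@Functor.Full.of_iso _ _ _ _ _ _ h₄ (partialDiagIso C).symm,
    @Functor.essSurj_of_iso _ _ _ _ _ _ h₅ (partialDiagIso C).symm⟩

end Prederivator

theorem mainTheorem4 (C : SSet.{max u v}) [SSet.Quasicategory C] :
    Prederivator.IsStrong (Prederivator.hoInfinity.{u, v} C) ∧
    (∀ F : Cat.{u, u}, Prederivator.IsFreeCategory F →
      (Prederivator.underlyingDiagram.{u, v} C F).Full ∧
      (Prederivator.underlyingDiagram.{u, v} C F).EssSurj) ∧
    (∀ A F : Cat.{u, u}, Prederivator.IsFreeCategory F →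
      (Prederivator.underlyingDiagram.{u, v} (SSet.expo C (Prederivator.smallNerve.{u, v} A)) F).Full ∧
      (Prederivator.underlyingDiagram.{u, v} (SSet.expo C (Prederivator.smallNerve.{u, v} A)) F).EssSurj) := by
  exact ⟨Prederivator.isStrong_hoInfinity C,
    fun _ hF ↦ ⟨Prederivator.full_underlyingDiagram hF, Prederivator.essSurj_underlyingDiagram hF⟩,
    fun _ _ hF ↦ ⟨Prederivator.full_underlyingDiagram hF, Prederivator.essSurj_underlyingDiagram hF⟩⟩
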